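/- Let $y_i=\beta\xi_i+\alpha+\delta_i$, $x_i=\xi_i+\varepsilon_i$, $i\ge 1$, with real $\alpha$ and $\beta\neq 0$, be a linear structural error-in-variables model such that: (A) $(\delta_i,\varepsilon_i)$, $i\ge1$, are i.i.d. copies of a mean-zero vector $(\delta,\varepsilon)$ with $E\delta^4<\infty$, $E\varepsilon^4<\infty$ and positive definite covariance matrix $\begin{pmatrix}\lambda\theta&\mu\\ \mu&\theta\end{pmatrix}$; (C) $\xi_i$, $i\ge1$, are i.i.d. copies of a random variable $\xi$, and the sequence $(\xi_i)$ is independent of the sequence $((\delta_i,\varepsilon_i))$; and such that $\xi$ is not almost surely constant and $E|\xi|^{8/3}<\infty$. The values $\lambda\theta=\operatorname{Var}\delta$ and $\mu=\operatorname{cov}(\delta,\varepsilon)$ are known. Put $c=0$ if $\alpha$ is known to be zero (model without intercept) and $c=1$ if $\alpha$ is unknown. For $u,v\in\{x,y\}$ let $\bar u=\frac1n\sum_{i=1}^n u_i$, $s_{i,uv}=(u_i-c\bar u)(v_i-c\bar v)$, $S_{uv}=\frac1n\sum_{i=1}^n s_{i,uv}$, and let $$\widehat\beta_{1n}=\frac{S_{yy}-\lambda\theta}{S_{xy}-\mu}\quad\text{if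 } S_{xy}-\mu\ne0 \text{ and } S_{yy}-\lambda\theta>0 .$$ For $0<\gamma<1$ let $z=z_{\gamma/2}$ be the number with $\Phi(z)=1-\gamma/2$, $\Phi$ the standard normal distribution function. Let $f_1(n)=n(n-1)$, $f_2(n)=n^2$, $g_1^{yy}=S_{yy}$, $g_2^{yy}=\lambda\theta$, $g_1^{xy}=S_{xy}$, $g_2^{xy}=\mu$, and for $k,l\in\{1,2\}$ let $$D_k=4z^2f_k(n)(S_{xy}-\mu)^2\sum_{i=1}^n\Big((s_{i,yy}-g_k^{yy})-\widehat\beta_{1n}(s_{i,xy}-g_k^{xy})\Big)^2-4z^4\Big(\sum_{i=1}^n(s_{i,yy}-g_k^{yy})^2\sum_{i=1}^n(s_{i,xy}-g_k^{xy})^2-\Big(\sum_{i=1}^n(s_{i,yy}-g_k^{yy})(s_{i,xy}-g_k^{xy})\Big)^2\Big),$$ $$B_k^l=\frac{f_k(n)(S_{xy}-\mu)^2\widehat\beta_{1n}-z^2\sum_{i=1}^n(s_{i,yy}-g_k^{yy})(s_{i,xy}-g_k^{xy})+(-1)^l\sqrt{D_k/4}}{f_k(n)(S_{xy}-\mu)^2-z^2\sum_{i=1}^n(s_{i,xy}-g_k^{xy})^2}.$$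 Then $\xi$ is in the domain of attraction of the normal law, i.e. $\big(\sum_{i=1}^n\xi_i-a_n\big)b_n^{-1}\to N(0,1)$ in distribution for some constants $a_n$ and $b_n>0$. Moreover, both for the model without intercept and for the model with unknown intercept, and for $k=1$ and $k=2$, $[B_k^1,B_k^2]$ is a large-sample approximate $1-\gamma$ confidence interval for $\beta$: $$P\big(B_k^1,B_k^2 \text{ are defined real numbers and } B_k^1\le\beta\le B_k^2\big)\to1-\gamma,\qquad n\to\infty .$$ It is the interval given by the Studentized ($k=1$), respectively self-normalized ($k=2$), statistic for $\beta$: with $u_i(b)=(s_{i,yy}-\lambda\theta)-b\,(s_{i,xy}-\mu)$ and $\overline{u(b)}=\frac1n\sum_{i=1}^n u_i(b)$, with probability tending to $1$ the numbers $B_k^1<B_k^2$ are defined and $[B_k^1,B_k^2]$ equals the set of all real $b$ such that $$\sqrt n\,\big|(S_{xy}-\mu)(\widehat\beta_{1n}-b)\big|\le z\Big(\sum_{i=1}^n\big(u_i(b)-\overline{u(b)}\big)^2/(n-1)\Big)^{1/2}\ (k=1),\qquad n\,\big|(S_{xy}-\mu)(\widehat\beta_{1n}-b)\big|\le z\Big(\sum_{i=1}^n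 u_i(b)^2\Big)^{1/2}\ (k=2).$$ -/

import Mathlib

open MeasureTheory ProbabilityTheory Filter Topology

namespace SEIVM

noncomputable section

/-! ### Sample quantities of observed numbers `u 0, …, u (n - 1)` -/

/-- Sample mean of the first `n` terms. -/
def mean (u : ℕ → ℝ) (n : ℕ) : ℝ := (∑ i ∈ Finset.range n, u i) / n

/-- `s_{i,uv} = (u_i - c ū)(v_i - c v̄)`. -/
def s (c : ℝ) (u v : ℕ → ℝ) (n i : ℕ) : ℝ := (u i - c * mean u n) * (v i - c * mean v n)

/-- `S_{uv}`, the sample mean of the `s_{i,uv}`. -/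
def S (c : ℝ) (u v : ℕ → ℝ) (n : ℕ) : ℝ := mean (s c u v n) n

/-! ### The estimator of the slope

Here and below `dd` is the known error variance `Var δ = λθ`, and `mu` the known error
covariance `cov(δ, ε)`. -/

/-- The modified least squares estimator `(S_yy - λθ) / (S_xy - μ)` of the slope. -/
def betaHat (c dd mu : ℝ) (x y : ℕ → ℝ) (n : ℕ) : ℝ := (S c y y n - dd) / (S c x y n - mu)

/-- The condition under which the estimator of the slope is defined. -/
def BetaHatDefined (c dd mu : ℝ) (x y : ℕ → ℝ) (n : ℕ) : Prop :=
  S c x y n - mu ≠ 0 ∧ 0 < S c y y n - dd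

/-! ### The two confidence intervals -/

/-- The two constructions: `studentized` is `k = 1`, `selfNormalized` is `k = 2`. -/
inductive Kind
  | studentized
  | selfNormalized

/-- `f_k(n)`. -/
def f : Kind → ℕ → ℝ
  | .studentized, n => (n : ℝ) * ((n : ℝ) - 1)
  | .selfNormalized, n => (n : ℝ) ^ 2

/-- The centring `g_k^{yy}`. -/
def gyy (k : Kind) (c dd : ℝ) (y : ℕ → ℝ) (n : ℕ) : ℝ :=
  match k with
  | .studentized => S c y y n
  | .selfNormalized => dd

/-- The centring `g_k^{xy}`. -/
def gxy (k : Kind) (c mu : ℝ) (x y : ℕ → ℝ) (n : ℕ) : ℝ :=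
  match k with
  | .studentized => S c x y n
  | .selfNormalized => mu

/-- The discriminant `D_k(n, z)`. -/
def D (k : Kind) (c dd mu z : ℝ) (x y : ℕ → ℝ) (n : ℕ) : ℝ :=
  4 * z ^ 2 * f k n * (S c x y n - mu) ^ 2 *
      (∑ i ∈ Finset.range n,
        ((s c y y n i - gyy k c dd y n)
          - betaHat c dd mu x y n * (s c x y n i - gxy k c mu x y n)) ^ 2)
    - 4 * z ^ 4 *
      ((∑ i ∈ Finset.range n, (s c y y n i - gyy k c dd y n) ^ 2) *
          (∑ i ∈ Finset.range n, (s c x y n i - gxy k c mu x y n) ^ 2)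
        - (∑ i ∈ Finset.range n,
            (s c y y n i - gyy k c dd y n) * (s c x y n i - gxy k c mu x y n)) ^ 2)

/-- The denominator of the endpoints. -/
def denom (k : Kind) (c mu z : ℝ) (x y : ℕ → ℝ) (n : ℕ) : ℝ :=
  f k n * (S c x y n - mu) ^ 2
    - z ^ 2 * ∑ i ∈ Finset.range n, (s c x y n i - gxy k c mu x y n) ^ 2

/-- The endpoints `B_k^l(n, z)`, `l = 1, 2`. -/
def B (k : Kind) (l : ℕ) (c dd mu z : ℝ) (x y : ℕ → ℝ) (n : ℕ) : ℝ :=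
  (f k n * (S c x y n - mu) ^ 2 * betaHat c dd mu x y n
      - z ^ 2 * (∑ i ∈ Finset.range n,
          (s c y y n i - gyy k c dd y n) * (s c x y n i - gxy k c mu x y n))
      + (-1) ^ l * √(D k c dd mu z x y n / 4))
    / denom k c mu z x y n

/-- The interval `[B_k^1(n, z), B_k^2(n, z)]`. -/
def interval (k : Kind) (c dd mu z : ℝ) (x y : ℕ → ℝ) (n : ℕ) : Set ℝ :=
  Set.Icc (B k 1 c dd mu z x y n) (B k 2 c dd mu z x y n)

/-- All expressions in the formula for the endpoints make sense as real numbers. -/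
def IntervalDefined (k : Kind) (c dd mu z : ℝ) (x y : ℕ → ℝ) (n : ℕ) : Prop :=
  BetaHatDefined c dd mu x y n ∧ 0 ≤ D k c dd mu z x y n ∧ denom k c mu z x y n ≠ 0

/-! ### The Studentized and self-normalized pivots -/

/-- `u_i(n) = (s_{i,yy} - λθ) - b (s_{i,xy} - μ)`, with a candidate value `b` for the slope. -/
def u (b c dd mu : ℝ) (x y : ℕ → ℝ) (n i : ℕ) : ℝ :=
  (s c y y n i - dd) - b * (s c x y n i - mu)

/-- The set of all candidate values `b` of the slope whose Studentized (resp. self-normalized)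
pivot is at most `z` in absolute value; the inequality is multiplied by the normalizer. -/
def pivotSet (k : Kind) (c dd mu z : ℝ) (x y : ℕ → ℝ) (n : ℕ) : Set ℝ :=
  match k with
  | .studentized =>
      {b | |√(n : ℝ) * (S c x y n - mu) * (betaHat c dd mu x y n - b)| ≤
        z * √((∑ i ∈ Finset.range n,
          (u b c dd mu x y n i - mean (u b c dd mu x y n) n) ^ 2) / ((n : ℝ) - 1))}
  | .selfNormalized =>
      {b | |(n : ℝ) * (S c x y n - mu) * (betaHat c dd mu x y n - b)| ≤
        z * √(∑ i ∈ Finset.range n, u b c dd mu x y n i ^ 2)}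

/-! ### The model -/

variable {Ω : Type*} [MeasurableSpace Ω]

/-- `X i` are i.i.d. random elements. -/
structure IID {E : Type*} [MeasurableSpace E] (P : Measure Ω) (X : ℕ → Ω → E) : Prop where
  measurable : ∀ i, Measurable (X i)
  indep : iIndepFun X P
  ident : ∀ i, IdentDistrib (X i) (X 0) P P

/-- The real random variables `X i` are i.i.d. in the domain of attraction of the normal law. -/
def IIDInDAN (P : Measure Ω) [IsProbabilityMeasure P] (X : ℕ → Ω → ℝ) : Prop :=
  IID P X ∧ ∃ a b : ℕ → ℝ, (∀ n, 0 < b n) ∧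
    TendstoInDistribution (fun n ω => ((∑ i ∈ Finset.range n, X i ω) - a n) * (b n)⁻¹) atTop
      (id : ℝ → ℝ) (fun _ => P) (gaussianReal 0 1)

/-- The condition on the errors: i.i.d. centred vectors with finite fourth moments and positive
definite covariance matrix with rows `(λθ, μ)` and `(μ, θ)`. -/
structure ErrorCondition (P : Measure Ω) (δ ε : ℕ → Ω → ℝ) (lam θ mu : ℝ) : Prop where
  iid : IID P (fun i ω => (δ i ω, ε i ω))
  integrable_δ : Integrable (fun ω => δ 0 ω ^ 4) P
  integrable_ε : Integrable (fun ω => ε 0 ω ^ 4) P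
  mean_δ : ∫ ω, δ 0 ω ∂P = 0
  mean_ε : ∫ ω, ε 0 ω ∂P = 0
  var_δ : Var[δ 0; P] = lam * θ
  cov_δε : cov[δ 0, ε 0; P] = mu
  var_ε : Var[ε 0; P] = θ
  posDef : (!![lam * θ, mu; mu, θ] : Matrix (Fin 2) (Fin 2) ℝ).PosDef

/-- The observed responses `y_i = β ξ_i + α + δ_i`, at the outcome `ω`. -/
def obsY (β α : ℝ) (ξ δ : ℕ → Ω → ℝ) (ω : Ω) (i : ℕ) : ℝ := β * ξ i ω + α + δ i ω

/-- The observed regressors `x_i = ξ_i + ε_i`, at the outcome `ω`. -/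
def obsX (ξ ε : ℕ → Ω → ℝ) (ω : Ω) (i : ℕ) : ℝ := ξ i ω + ε i ω

end

end SEIVM

namespace SEIVM

/-! ### The quadratic inequality that defines the interval -/

/-! Write `η_i = δ_i - β ε_i`. The numerator `(S_xy - μ)(β̂ - b)` of the pivot is the sample mean of
the `u_i(b)`, so that both pivots at `b` are self-normalized means, and "`|pivot| ≤ z`" is, after
squaring, a quadratic inequality in `b` with leading coefficient `denom`. When `denom > 0`, its
solution set is the interval between the roots `B 1` and `B 2` (`mem_interval_iff`,
`mem_pivotSet_iff`). Coverage of `β` is then the event that the pivot at `β` lies in `[-z, z]`.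

At `b = β` the mean of the `u_i` is the mean of the i.i.d. centred variables `(y_i - c E y) η_i -
(λθ - βμ)` minus the product of two errors of sample means (`mean_u_eq`). These variables are square
integrable although `ξ` need not have a fourth moment, because `ξ` is independent of `η`
(`integral_leadTerm_sq_pos`). The central limit theorem, the law of large numbers for the squares
and Slutsky's lemma give a standard normal limit (`tendstoInDistribution_pivot`).

It remains that `denom > 0` eventually, almost surely. The squares of the `s_{i,xy}` need not have a
mean, but their sum is `o(n²)`, being at most the maximum of the `x_i²`, which is `o(n)`, times a
sum of order `n`, up to lower-order terms (`tendsto_sumSqXY_div_sq`). The same estimate gives `B 1 <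
B 2` with probability tending to one (`sum_resid_betaHat_pos`). The moment of order `8/3` enters
through the finite second moment, which also puts `ξ` in the domain of attraction. -/

/-- For a quadratic `p(b) = a b² - 2 h b + e`, a quarter of the discriminant is `(a t - h)² - a
p(t)` at any point `t`. At the estimate `t` the term `F (t - b)²` of `p` vanishes, so `p(t) ≤ 0` is
visible and the roots are real when `a > 0`. -/
lemma discriminant_eq (F A C Q t w : ℝ) :
    w * F * (A - 2 * t * C + t ^ 2 * Q) - w ^ 2 * (A * Q - C ^ 2) =
      (w * (A - 2 * t * C + t ^ 2 * Q)) * (F - w * Q) + (F * t - w * C - (F - w * Q) * t) ^ 2 := by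
  ring

/-- Completing the square, after multiplication by the positive leading coefficient `F - w Q`. -/
lemma mem_Icc_iff_quadratic_le {F A C Q t w r b : ℝ} (hden : 0 < F - w * Q) (hr : 0 ≤ r)
    (hr2 : r ^ 2 = w * F * (A - 2 * t * C + t ^ 2 * Q) - w ^ 2 * (A * Q - C ^ 2)) :
    b ∈ Set.Icc ((F * t - w * C - r) / (F - w * Q)) ((F * t - w * C + r) / (F - w * Q)) ↔
      F * (t - b) ^ 2 ≤ w * (A - 2 * b * C + b ^ 2 * Q) := by
  have key : ((F - w * Q) * b - (F * t - w * C)) ^ 2 - r ^ 2 =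
      (F - w * Q) * (F * (t - b) ^ 2 - w * (A - 2 * b * C + b ^ 2 * Q)) := by rw [hr2]; ring
  rw [Set.mem_Icc, div_le_iff₀ hden, le_div_iff₀ hden]
  have h1 : F * (t - b) ^ 2 ≤ w * (A - 2 * b * C + b ^ 2 * Q) ↔
      ((F - w * Q) * b - (F * t - w * C)) ^ 2 ≤ r ^ 2 := by
    rw [← sub_nonpos, ← sub_nonpos (a := _ ^ 2), key]
    exact ⟨fun h => mul_nonpos_of_nonneg_of_nonpos hden.le h, fun h => by
      by_contra! hc
      exact absurd h (not_le.2 (mul_pos hden hc))⟩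
  rw [h1, sq_le_sq, abs_of_nonneg hr, abs_le]
  constructor
  · rintro ⟨h2, h3⟩; constructor <;> linarith
  · rintro ⟨h2, h3⟩; constructor <;> linarith

/-- The residual `(s_{i,yy} - g^{yy}) - b (s_{i,xy} - g^{xy})` at a candidate slope `b`. -/
noncomputable def resid (k : Kind) (b c dd mu : ℝ) (x y : ℕ → ℝ) (n i : ℕ) : ℝ :=
  (s c y y n i - gyy k c dd y n) - b * (s c x y n i - gxy k c mu x y n)

/-- The sum of squares of the `s_{i,xy} - g^{xy}`. -/
noncomputable def sumSqXY (k : Kind) (c mu : ℝ) (x y : ℕ → ℝ) (n : ℕ) : ℝ :=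
  ∑ i ∈ Finset.range n, (s c x y n i - gxy k c mu x y n) ^ 2

section algebra

variable {k : Kind} {c dd mu z b : ℝ} {x y : ℕ → ℝ} {n : ℕ}

lemma sum_resid_sq (b : ℝ) :
    ∑ i ∈ Finset.range n, resid k b c dd mu x y n i ^ 2 =
      ∑ i ∈ Finset.range n, (s c y y n i - gyy k c dd y n) ^ 2
      - 2 * b * ∑ i ∈ Finset.range n,
          (s c y y n i - gyy k c dd y n) * (s c x y n i - gxy k c mu x y n)
      + b ^ 2 * ∑ i ∈ Finset.range n, (s c x y n i - gxy k c mu x y n) ^ 2 := by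
  simp only [Finset.mul_sum, ← Finset.sum_sub_distrib, ← Finset.sum_add_distrib, resid]
  exact Finset.sum_congr rfl fun i _ => by ring

lemma D_div_four :
    D k c dd mu z x y n / 4 =
      z ^ 2 * (∑ i ∈ Finset.range n, resid k (betaHat c dd mu x y n) c dd mu x y n i ^ 2) *
          denom k c mu z x y n
        + (f k n * (S c x y n - mu) ^ 2 * betaHat c dd mu x y n
          - z ^ 2 * (∑ i ∈ Finset.range n,
            (s c y y n i - gyy k c dd y n) * (s c x y n i - gxy k c mu x y n))
          - denom k c mu z x y n * betaHat c dd mu x y n) ^ 2 := by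
  have h := sum_resid_sq (k := k) (c := c) (dd := dd) (mu := mu) (x := x) (y := y) (n := n)
    (betaHat c dd mu x y n)
  have h' := h
  simp only [resid] at h'
  rw [D, denom, h, h', ← discriminant_eq]
  ring

lemma D_nonneg (hden : 0 < denom k c mu z x y n) : 0 ≤ D k c dd mu z x y n := by
  have h : 0 ≤ D k c dd mu z x y n / 4 := by
    rw [D_div_four]
    have := Finset.sum_nonneg (s := Finset.range n)
      fun i _ => sq_nonneg (resid k (betaHat c dd mu x y n) c dd mu x y n i)
    positivity
  linarith

lemma B_one_lt_B_two (hz : 0 < z) (hden : 0 < denom k c mu z x y n)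
    (hV : 0 < ∑ i ∈ Finset.range n, resid k (betaHat c dd mu x y n) c dd mu x y n i ^ 2) :
    B k 1 c dd mu z x y n < B k 2 c dd mu z x y n := by
  have h : 0 < D k c dd mu z x y n / 4 := by
    rw [D_div_four]
    positivity
  have h2 := Real.sqrt_pos.2 h
  refine div_lt_div_of_pos_right ?_ hden
  norm_num
  linarith

lemma mem_interval_iff (hden : 0 < denom k c mu z x y n) :
    b ∈ interval k c dd mu z x y n ↔
      f k n * (S c x y n - mu) ^ 2 * (betaHat c dd mu x y n - b) ^ 2 ≤
        z ^ 2 * ∑ i ∈ Finset.range n, resid k b c dd mu x y n i ^ 2 := by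
  have hD : 0 ≤ D k c dd mu z x y n / 4 := div_nonneg (D_nonneg hden) (by norm_num)
  rw [sum_resid_sq, ← mem_Icc_iff_quadratic_le hden (Real.sqrt_nonneg _)
    ((Real.sq_sqrt hD).trans ?_)]
  · simp only [interval, B, denom]
    norm_num [sub_eq_add_neg]
  · rw [D_div_four, discriminant_eq, sum_resid_sq]
    simp only [denom]

/-- The case `n = 0` is separate because division by zero makes `mean` vanish there, while the other
expression becomes `-dd + b * mu`. -/
lemma mean_u : mean (u b c dd mu x y n) n =
    if n = 0 then 0 else (S c y y n - dd) - b * (S c x y n - mu) := by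
  rcases eq_or_ne n 0 with rfl | hn
  · simp [mean]
  · have : (n : ℝ) ≠ 0 := by exact_mod_cast hn
    simp only [hn, if_false, mean, S, u, Finset.sum_sub_distrib, ← Finset.mul_sum]
    simp
    field_simp

lemma betaHat_sub (hn : n ≠ 0) (hS : S c x y n - mu ≠ 0) :
    (S c x y n - mu) * (betaHat c dd mu x y n - b) = mean (u b c dd mu x y n) n := by
  rw [mean_u, if_neg hn, betaHat]
  field_simp

lemma resid_studentized (hn : n ≠ 0) (i : ℕ) :
    resid .studentized b c dd mu x y n i =
      u b c dd mu x y n i - mean (u b c dd mu x y n) n := by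
  rw [mean_u, if_neg hn]
  simp only [resid, gyy, gxy, u]
  ring

lemma resid_selfNormalized (i : ℕ) :
    resid .selfNormalized b c dd mu x y n i = u b c dd mu x y n i := rfl

lemma f_pos (hn : 2 ≤ n) : 0 < f k n := by
  have : (2 : ℝ) ≤ n := by exact_mod_cast hn
  cases k
  · simp only [f]; nlinarith
  · simp only [f]; positivity

lemma mem_pivotSet_iff (hn : 2 ≤ n) (hz : 0 < z) :
    b ∈ pivotSet k c dd mu z x y n ↔
      f k n * (S c x y n - mu) ^ 2 * (betaHat c dd mu x y n - b) ^ 2 ≤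
        z ^ 2 * ∑ i ∈ Finset.range n, resid k b c dd mu x y n i ^ 2 := by
  have hn' : (2 : ℝ) ≤ n := by exact_mod_cast hn
  cases k
  · simp only [pivotSet, Set.mem_ofPred_eq, f, resid_studentized (by omega : n ≠ 0)]
    have hs : 0 ≤ ∑ i ∈ Finset.range n,
      (u b c dd mu x y n i - mean (u b c dd mu x y n) n) ^ 2 := by positivity
    have h1 : (0 : ℝ) < n - 1 := by linarith
    rw [← abs_of_nonneg (mul_nonneg hz.le (Real.sqrt_nonneg _)), ← sq_le_sq, mul_pow, mul_pow,
      mul_pow, Real.sq_sqrt (by linarith), Real.sq_sqrt (by positivity), ← mul_div_assoc,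
      le_div_iff₀ h1, show (n : ℝ) * (S c x y n - mu) ^ 2 * (betaHat c dd mu x y n - b) ^ 2 *
        (n - 1) = n * (n - 1) * (S c x y n - mu) ^ 2 * (betaHat c dd mu x y n - b) ^ 2 by ring]
  · simp only [pivotSet, Set.mem_ofPred_eq, f, resid_selfNormalized]
    have hs : 0 ≤ ∑ i ∈ Finset.range n, u b c dd mu x y n i ^ 2 := by positivity
    rw [← abs_of_nonneg (mul_nonneg hz.le (Real.sqrt_nonneg _)), ← sq_le_sq, mul_pow, mul_pow,
      mul_pow, Real.sq_sqrt hs]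

/-- The residuals at the estimated slope do not all vanish if the squared pivot at `b` is smaller
than the ratio of `f (S_xy - μ)²` and `∑ (s_{i,xy} - g^{xy})²`. -/
lemma sum_resid_betaHat_pos (hn : n ≠ 0) (hS : S c x y n - mu ≠ 0)
    (hlt : f k n * mean (u b c dd mu x y n) n ^ 2 * sumSqXY k c mu x y n <
      (∑ i ∈ Finset.range n, resid k b c dd mu x y n i ^ 2) * (f k n * (S c x y n - mu) ^ 2)) :
    0 < ∑ i ∈ Finset.range n, resid k (betaHat c dd mu x y n) c dd mu x y n i ^ 2 := by
  set t := betaHat c dd mu x y n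
  refine lt_of_le_of_ne (by positivity) fun h0 => ?_
  have hz := (Finset.sum_eq_zero_iff_of_nonneg fun i _ => sq_nonneg _).1 h0.symm
  have hr : ∑ i ∈ Finset.range n, resid k b c dd mu x y n i ^ 2 =
      (t - b) ^ 2 * sumSqXY k c mu x y n := by
    rw [sumSqXY, Finset.mul_sum]
    refine Finset.sum_congr rfl fun i hi => ?_
    have := pow_eq_zero_iff (two_ne_zero) |>.1 (hz i hi)
    -- Residuals are affine in the slope; if they vanish at `t`, those at `b` are `t - b` times the
    -- `xy` terms, and the assumed strict inequality becomes an equality.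
    have h2 : resid k b c dd mu x y n i = (t - b) * (s c x y n i - gxy k c mu x y n) := by
      simp only [resid] at this ⊢
      linarith
    rw [h2, mul_pow]
  rw [hr, ← betaHat_sub hn hS] at hlt
  exact absurd hlt (not_lt.2 (le_of_eq (by ring)))

end algebra

end SEIVM

namespace SEIVM

/-! ### Limits along a fixed sequence of observations -/

section means

variable {X v : ℕ → ℝ} {n : ℕ}

/-- The last term is recovered from two consecutive means, which have the same limit. -/
lemma tendsto_div_succ_of_tendsto_mean {L : ℝ} (h : Tendsto (mean X) atTop (𝓝 L)) :
    Tendsto (fun n : ℕ => X n / ((n : ℝ) + 1)) atTop (𝓝 0) := by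
  have h1 : Tendsto (fun n : ℕ => mean X (n + 1) - mean X n * ((n : ℝ) / ((n : ℝ) + 1)))
      atTop (𝓝 (L - L * 1)) :=
    ((tendsto_add_atTop_iff_nat 1).2 h).sub (h.mul (tendsto_natCast_div_add_atTop (1 : ℝ)))
  rw [mul_one, sub_self] at h1
  refine h1.congr fun n => ?_
  have hn : (n : ℝ) + 1 ≠ 0 := by positivity
  rcases eq_or_ne n 0 with rfl | h0
  · simp [mean]
  · have h0' : (n : ℝ) ≠ 0 := by exact_mod_cast h0
    simp only [mean, Finset.sum_range_succ, Nat.cast_add, Nat.cast_one]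
    field_simp
    ring

/-- The maximum of the first `n` terms is `o(n)` from above: beyond some `N` one has `X i ≤ e (i +
1) ≤ e n`, and the finitely many earlier terms are absorbed as `e n` grows. -/
lemma eventually_forall_le_mul {L : ℝ} (h : Tendsto (mean X) atTop (𝓝 L)) {e : ℝ} (he : 0 < e) :
    ∀ᶠ n : ℕ in atTop, ∀ i < n, X i ≤ e * n := by
  obtain ⟨N, hN⟩ := eventually_atTop.1
    ((tendsto_div_succ_of_tendsto_mean h).eventually (gt_mem_nhds he))
  have h2 : ∀ᶠ n : ℕ in atTop, ∀ i ∈ Finset.range N, X i ≤ e * n := by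
    rw [Filter.eventually_all_finset]
    exact fun i _ =>
      (tendsto_natCast_atTop_atTop.const_mul_atTop he).eventually (eventually_ge_atTop _)
  filter_upwards [h2] with n hn i hi
  by_cases hiN : i < N
  · exact hn i (Finset.mem_range.2 hiN)
  · have h3 := hN i (not_lt.1 hiN)
    rw [div_lt_iff₀ (by positivity)] at h3
    have h4 : (i : ℝ) + 1 ≤ n := by exact_mod_cast hi
    nlinarith

lemma tendsto_sum_mul_div_sq {Y : ℕ → ℕ → ℝ} {L L' : ℝ} (hX0 : ∀ i, 0 ≤ X i)
    (hY0 : ∀ n i, 0 ≤ Y n i) (hX : Tendsto (mean X) atTop (𝓝 L))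
    (hY : Tendsto (fun n => mean (Y n) n) atTop (𝓝 L')) :
    Tendsto (fun n : ℕ => (∑ i ∈ Finset.range n, X i * Y n i) / (n : ℝ) ^ 2) atTop (𝓝 0) := by
  refine tendsto_order.2 ⟨fun a ha => .of_forall fun n => ha.trans_le ?_, fun a ha => ?_⟩
  · exact div_nonneg (Finset.sum_nonneg fun i _ => mul_nonneg (hX0 i) (hY0 n i)) (by positivity)
  -- `|L'| + 1` is positive and eventually bounds the means of `Y`, whatever the value of `L'`.
  · have hL : 0 < |L'| + 1 := by positivity
    have he : 0 < a / (|L'| + 1) := by positivity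
    filter_upwards [eventually_forall_le_mul hX he, eventually_gt_atTop 0,
      hY.eventually (gt_mem_nhds (lt_of_le_of_lt (le_abs_self L') (lt_add_one _)))]
      with n hn hn0 hYn
    have hn0' : (0 : ℝ) < n := by exact_mod_cast hn0
    have h1 : ∑ i ∈ Finset.range n, X i * Y n i ≤
        a / (|L'| + 1) * n * ∑ i ∈ Finset.range n, Y n i := by
      rw [Finset.mul_sum]
      exact Finset.sum_le_sum fun i hi =>
        mul_le_mul_of_nonneg_right (hn i (Finset.mem_range.1 hi)) (hY0 n i)
    have h2 : ∑ i ∈ Finset.range n, Y n i = n * mean (Y n) n := by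
      rw [mean]; field_simp
    rw [div_lt_iff₀ (by positivity)]
    calc _ ≤ a / (|L'| + 1) * n * (n * mean (Y n) n) := h2 ▸ h1
      _ < a / (|L'| + 1) * n * (n * (|L'| + 1)) := by gcongr
      _ = a * (n : ℝ) ^ 2 := by field_simp

lemma mean_nonneg (h : ∀ i, 0 ≤ X i) : 0 ≤ mean X n :=
  div_nonneg (Finset.sum_nonneg fun i _ => h i) n.cast_nonneg

lemma mean_mul_sq_le (a b : ℕ → ℝ) (n : ℕ) :
    mean (fun i => a i * b i) n ^ 2 ≤ mean (fun i => a i ^ 2) n * mean (fun i => b i ^ 2) n := by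
  simp only [mean, div_pow, div_mul_div_comm, ← sq]
  gcongr
  exact Finset.sum_mul_sq_le_sq_mul_sq _ _ _

lemma mean_mono {a b : ℕ → ℝ} (h : ∀ i, a i ≤ b i) (n : ℕ) : mean a n ≤ mean b n := by
  unfold mean
  gcongr with i
  exact h i

/-- The cross term is negligible by Cauchy–Schwarz. -/
lemma tendsto_mean_sq_add {v w : ℕ → ℕ → ℝ} {L : ℝ}
    (hv : Tendsto (fun n => mean (fun i => v n i ^ 2) n) atTop (𝓝 L))
    (hw : Tendsto (fun n => mean (fun i => w n i ^ 2) n) atTop (𝓝 0)) :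
    Tendsto (fun n => mean (fun i => (v n i + w n i) ^ 2) n) atTop (𝓝 L) := by
  have h1 : Tendsto (fun n => mean (fun i => v n i * w n i) n ^ 2) atTop (𝓝 0) := by
    have := hv.mul hw
    rw [mul_zero] at this
    exact squeeze_zero (fun n => sq_nonneg _) (fun n => mean_mul_sq_le _ _ n) this
  have h2 : Tendsto (fun n => mean (fun i => v n i * w n i) n) atTop (𝓝 0) := by
    rw [tendsto_zero_iff_abs_tendsto_zero]
    have := h1.sqrt
    simpa [Real.sqrt_sq_eq_abs, Function.comp_def] using this
  have h3 := (hv.add (h2.const_mul 2)).add hw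
  simp only [mul_zero, add_zero] at h3
  refine h3.congr fun n => ?_
  simp only [mean, ← mul_div_assoc, ← add_div, Finset.mul_sum, ← Finset.sum_add_distrib]
  congr 1
  exact Finset.sum_congr rfl fun i _ => by ring

/-- The hypothesis `c ^ 2 = c` treats `c = 0` and `c = 1` at once. -/
lemma S_eq {c : ℝ} (hc : c ^ 2 = c) (x y : ℕ → ℝ) (n : ℕ) :
    S c x y n = mean (fun i => x i * y i) n - c * (mean x n * mean y n) := by
  rcases eq_or_ne n 0 with rfl | hn
  · simp [S, mean]
  have h0 : (n : ℝ) ≠ 0 := by exact_mod_cast hn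
  have h1 : ∀ i, s c x y n i =
      x i * y i - c * mean y n * x i - c * mean x n * y i + c * (mean x n * mean y n) := by
    intro i
    simp only [s]
    linear_combination (mean x n * mean y n) * hc
  have hx : ∑ i ∈ Finset.range n, x i = n * mean x n := by rw [mean]; field_simp
  have hy : ∑ i ∈ Finset.range n, y i = n * mean y n := by rw [mean]; field_simp
  have h2 : ∑ i ∈ Finset.range n, s c x y n i =
      ∑ i ∈ Finset.range n, x i * y i - n * (c * (mean x n * mean y n)) := by
    simp only [h1, Finset.sum_add_distrib, Finset.sum_sub_distrib, ← Finset.mul_sum, hx, hy,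
      Finset.sum_const, Finset.card_range, nsmul_eq_mul]
    ring
  rw [S, mean.eq_1 (s c x y n), h2, sub_div, mul_div_cancel_left₀ _ h0]
  rfl

end means

/-- The residual `η_i = y_i - β x_i - α` of the true line. -/
def lineResid (β α : ℝ) (x y : ℕ → ℝ) (i : ℕ) : ℝ := y i - β * x i - α

/-- The leading term `(y_i - c E y) η_i - (λθ - β μ)` of `u_i`. -/
def leadTerm (β α c my κ : ℝ) (x y : ℕ → ℝ) (i : ℕ) : ℝ :=
  (y i - c * my) * lineResid β α x y i - κ

/-- The laws of large numbers that a typical sequence of observations satisfies. -/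
structure SampleLimits (β α c dd mu mx my mxx mxy myy h v : ℝ) (x y : ℕ → ℝ) : Prop where
  mean_x : Tendsto (mean x) atTop (𝓝 mx)
  mean_y : Tendsto (mean y) atTop (𝓝 my)
  mean_xx : Tendsto (mean fun i => x i ^ 2) atTop (𝓝 mxx)
  mean_xy : Tendsto (mean fun i => x i * y i) atTop (𝓝 mxy)
  mean_yy : Tendsto (mean fun i => y i * y i) atTop (𝓝 myy)
  mean_η : Tendsto (mean (lineResid β α x y)) atTop (𝓝 0)
  mean_ηη : Tendsto (mean fun i => lineResid β α x y i ^ 2) atTop (𝓝 h)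
  mean_lead : Tendsto (mean (leadTerm β α c my (dd - β * mu) x y)) atTop (𝓝 0)
  mean_lead_sq : Tendsto (mean fun i => leadTerm β α c my (dd - β * mu) x y i ^ 2) atTop (𝓝 v)

section limits

variable {β α c dd mu mx my mxx mxy myy h v : ℝ} {x y : ℕ → ℝ}

/-- Since `(1 - c) α = 0`, the intercept cancels and `u_i = (y_i - c ȳ)(η_i - c η̄) - κ` in both
models, with `κ = dd - β mu`. Replacing `ȳ` by its limit `my` gives the correction in parentheses.
-/
lemma u_eq (hα : (1 - c) * α = 0) {n : ℕ} (hn : n ≠ 0) (i : ℕ) :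
    u β c dd mu x y n i = leadTerm β α c my (dd - β * mu) x y i +
      (c * (mean y n - my) * (c * mean (lineResid β α x y) n)
        - c * (mean y n - my) * lineResid β α x y i
        - c * mean (lineResid β α x y) n * (y i - c * my)) := by
  have h0 : (n : ℝ) ≠ 0 := by exact_mod_cast hn
  have h1 : mean (lineResid β α x y) n = mean y n - β * mean x n - α := by
    simp only [mean, lineResid, Finset.sum_sub_distrib, ← Finset.mul_sum, Finset.sum_const,
      Finset.card_range, nsmul_eq_mul]
    field_simp
  rw [h1]
  simp only [u, s, leadTerm, lineResid]
  linear_combination (y i - c * mean y n) * hα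

/-- The correction is a product of two centred sample means, hence still negligible after
multiplication by `√n`. -/
lemma mean_u_eq (hc : c ^ 2 = c) (hα : (1 - c) * α = 0) (n : ℕ) :
    mean (u β c dd mu x y n) n = mean (leadTerm β α c my (dd - β * mu) x y) n
      - c * (mean y n - my) * mean (lineResid β α x y) n := by
  rcases eq_or_ne n 0 with rfl | hn
  · simp [mean]
  have h0 : (n : ℝ) ≠ 0 := by exact_mod_cast hn
  have hη : ∑ i ∈ Finset.range n, lineResid β α x y i = n * mean (lineResid β α x y) n := by
    rw [mean]; field_simp
  have hy : ∑ i ∈ Finset.range n, y i = n * mean y n := by rw [mean]; field_simp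
  have hl : ∑ i ∈ Finset.range n, leadTerm β α c my (dd - β * mu) x y i =
      n * mean (leadTerm β α c my (dd - β * mu) x y) n := by
    rw [mean]; field_simp
  rw [mean, div_eq_iff h0]
  simp only [u_eq (my := my) hα hn, Finset.sum_add_distrib, Finset.sum_sub_distrib,
    ← Finset.mul_sum, Finset.sum_const, Finset.card_range, nsmul_eq_mul, hη, hy, hl]
  linear_combination n * mean y n * mean (lineResid β α x y) n * hc

namespace SampleLimits

variable (H : SampleLimits β α c dd mu mx my mxx mxy myy h v x y)
include H

lemma tendsto_Sxy (hc : c ^ 2 = c) : Tendsto (S c x y) atTop (𝓝 (mxy - c * (mx * my))) := by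
  simp only [funext (S_eq hc x y)]
  exact H.mean_xy.sub ((H.mean_x.mul H.mean_y).const_mul c)

lemma tendsto_Syy (hc : c ^ 2 = c) : Tendsto (S c y y) atTop (𝓝 (myy - c * (my * my))) := by
  simp only [funext (S_eq hc y y)]
  exact H.mean_yy.sub ((H.mean_y.mul H.mean_y).const_mul c)

lemma tendsto_mean_u (hc : c ^ 2 = c) (hα : (1 - c) * α = 0) :
    Tendsto (fun n => mean (u β c dd mu x y n) n) atTop (𝓝 0) := by
  simp only [mean_u_eq (my := my) hc hα]
  have := H.mean_lead.sub (((H.mean_y.sub_const my).const_mul c).mul H.mean_η)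
  simpa using this

lemma tendsto_mean_u_sq (hα : (1 - c) * α = 0) :
    Tendsto (fun n => mean (fun i => u β c dd mu x y n i ^ 2) n) atTop (𝓝 v) := by
  set p : ℕ → ℝ := fun n => c * (mean y n - my)
  set q : ℕ → ℝ := fun n => c * mean (lineResid β α x y) n
  have hp : Tendsto p atTop (𝓝 0) := by simpa using (H.mean_y.sub_const my).const_mul c
  have hq : Tendsto q atTop (𝓝 0) := by simpa using H.mean_η.const_mul c
  have hw : Tendsto (fun n => mean (fun i => (p n * q n - p n * lineResid β α x y i
      - q n * (y i - c * my)) ^ 2) n) atTop (𝓝 0) := by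
    -- The factor `3` comes from squaring a sum of three terms, the factor `2` from `(a - b)² ≤ 2 a²
    -- + 2 b²`.
    have hb : Tendsto (fun n => 3 * (p n * q n) ^ 2
        + 3 * p n ^ 2 * mean (fun i => lineResid β α x y i ^ 2) n
        + 3 * q n ^ 2 * (2 * mean (fun i => y i * y i) n + 2 * (c * my) ^ 2)) atTop
        (𝓝 (3 * (0 * 0) ^ 2 + 3 * 0 ^ 2 * h + 3 * 0 ^ 2 * (2 * myy + 2 * (c * my) ^ 2))) :=
      ((((hp.mul hq).pow 2).const_mul 3).add (((hp.pow 2).const_mul 3).mul H.mean_ηη)).add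
        (((hq.pow 2).const_mul 3).mul ((H.mean_yy.const_mul 2).add_const _))
    have h0 : (3 * (0 * 0) ^ 2 + 3 * 0 ^ 2 * h + 3 * 0 ^ 2 * (2 * myy + 2 * (c * my) ^ 2)) =
      (0 : ℝ) := by ring
    rw [h0] at hb
    refine squeeze_zero' (.of_forall fun n => mean_nonneg fun i => sq_nonneg _) ?_ hb
    filter_upwards [eventually_ne_atTop 0] with n hn
    have hn0 : (n : ℝ) ≠ 0 := by exact_mod_cast hn
    refine (mean_mono (b := fun i => 3 * (p n * q n) ^ 2 + 3 * p n ^ 2 * lineResid β α x y i ^ 2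
      + 3 * q n ^ 2 * (2 * (y i * y i) + 2 * (c * my) ^ 2)) (fun i => ?_) n).trans (le_of_eq ?_)
    · have e1 : (y i - c * my) ^ 2 ≤ 2 * (y i * y i) + 2 * (c * my) ^ 2 := by
        nlinarith [sq_nonneg (y i + c * my)]
      have e2 := mul_le_mul_of_nonneg_left e1 (by positivity : 0 ≤ 3 * q n ^ 2)
      nlinarith [sq_nonneg (p n * q n + p n * lineResid β α x y i),
        sq_nonneg (p n * q n + q n * (y i - c * my)),
        sq_nonneg (p n * lineResid β α x y i - q n * (y i - c * my))]
    · simp only [mean, Finset.sum_add_distrib, ← Finset.mul_sum, Finset.sum_const,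
        Finset.card_range, nsmul_eq_mul]
      field_simp
  refine (tendsto_mean_sq_add (v := fun _ i => leadTerm β α c my (dd - β * mu) x y i)
    H.mean_lead_sq hw).congr' ?_
  filter_upwards [eventually_ne_atTop 0] with n hn
  simp only [u_eq (my := my) hα hn, p, q]

lemma tendsto_sum_resid_sq (hc : c ^ 2 = c) (hα : (1 - c) * α = 0) (k : Kind) :
    Tendsto (fun n : ℕ => (∑ i ∈ Finset.range n, resid k β c dd mu x y n i ^ 2) / n)
      atTop (𝓝 v) := by
  cases k
  · have h1 := (H.tendsto_mean_u_sq hα).sub ((H.tendsto_mean_u hc hα).pow 2)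
    rw [zero_pow two_ne_zero, sub_zero] at h1
    refine h1.congr' ?_
    filter_upwards [eventually_ne_atTop 0] with n hn
    have h0 : (n : ℝ) ≠ 0 := by exact_mod_cast hn
    set m := mean (u β c dd mu x y n) n with hm
    have hsum : ∑ i ∈ Finset.range n, u β c dd mu x y n i = n * m := by
      rw [hm, mean]; field_simp
    have : ∀ i, (u β c dd mu x y n i - m) ^ 2 =
        u β c dd mu x y n i ^ 2 - 2 * m * u β c dd mu x y n i + m ^ 2 := fun i => by ring
    simp only [resid_studentized hn, ← hm, this, Finset.sum_add_distrib, Finset.sum_sub_distrib,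
      ← Finset.mul_sum, hsum, Finset.sum_const, Finset.card_range, nsmul_eq_mul]
    rw [mean]
    field_simp
    ring
  · exact H.tendsto_mean_u_sq hα

omit H in
lemma tendsto_f_div (k : Kind) : Tendsto (fun n : ℕ => f k n / (n : ℝ) ^ 2) atTop (𝓝 1) := by
  cases k
  · have h1 : Tendsto (fun n : ℕ => 1 - ((n : ℝ))⁻¹) atTop (𝓝 (1 - 0)) :=
      tendsto_const_nhds.sub tendsto_inv_atTop_nhds_zero_nat
    rw [sub_zero] at h1
    refine h1.congr' ?_
    filter_upwards [eventually_ne_atTop 0] with n hn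
    have h0 : (n : ℝ) ≠ 0 := by exact_mod_cast hn
    simp only [f]
    field_simp
  · refine tendsto_const_nhds.congr' ?_
    filter_upwards [eventually_ne_atTop 0] with n hn
    have h0 : (n : ℝ) ≠ 0 := by exact_mod_cast hn
    simp only [f]
    field_simp

lemma tendsto_gxy (hc : c ^ 2 = c) (k : Kind) :
    ∃ g, Tendsto (gxy k c mu x y) atTop (𝓝 g) := by
  cases k
  · exact ⟨_, H.tendsto_Sxy hc⟩
  · exact ⟨mu, tendsto_const_nhds⟩

/-- The normalization is `n²` because no fourth moment of `ξ` is at hand; the main part is `∑ x_i²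
(y_i - c ȳ)²`, handled by `tendsto_sum_mul_div_sq`. -/
lemma tendsto_sumSqXY_div_sq (hc : c ^ 2 = c) (k : Kind) :
    Tendsto (fun n : ℕ => sumSqXY k c mu x y n / (n : ℝ) ^ 2) atTop (𝓝 0) := by
  obtain ⟨g, hg⟩ := H.tendsto_gxy hc k
  have hY : Tendsto (fun n => mean (fun i => (y i - c * mean y n) ^ 2) n) atTop
      (𝓝 (myy - c * (my * my))) := by
    refine (H.tendsto_Syy hc).congr fun n => ?_
    exact congrArg (fun a => mean a n) (funext fun i => (sq _).symm)
  have h1 := tendsto_sum_mul_div_sq (fun i => sq_nonneg (x i)) (fun n i => sq_nonneg _) H.mean_xx hY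
  have hinv : Tendsto (fun n : ℕ => ((n : ℝ))⁻¹) atTop (𝓝 0) := tendsto_inv_atTop_nhds_zero_nat
  have h2 := ((h1.const_mul 4).add (((((H.mean_x.const_mul c).pow 2).mul hY).mul hinv).const_mul 4)).add
    (((hg.pow 2).mul hinv).const_mul 2)
  simp only [mul_zero, add_zero] at h2
  refine squeeze_zero' (.of_forall fun n => div_nonneg
    (Finset.sum_nonneg fun i _ => sq_nonneg _) (by positivity)) ?_ h2
  filter_upwards [eventually_ne_atTop 0] with n hn
  have h0 : (n : ℝ) ≠ 0 := by exact_mod_cast hn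
  have h3 : sumSqXY k c mu x y n ≤ ∑ i ∈ Finset.range n,
      (4 * (x i ^ 2 * (y i - c * mean y n) ^ 2)
        + 4 * (c * mean x n) ^ 2 * (y i - c * mean y n) ^ 2 + 2 * gxy k c mu x y n ^ 2) := by
    refine Finset.sum_le_sum fun i _ => ?_
    simp only [s]
    nlinarith [sq_nonneg ((x i - c * mean x n) * (y i - c * mean y n) + gxy k c mu x y n),
      sq_nonneg ((x i + c * mean x n) * (y i - c * mean y n))]
  calc _ ≤ _ := div_le_div_of_nonneg_right h3 (by positivity)
    _ = _ := by
      simp only [Finset.sum_add_distrib, ← Finset.mul_sum, Finset.sum_const, Finset.card_range,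
        nsmul_eq_mul]
      rw [mean.eq_1 (fun i => (y i - c * mean y n) ^ 2)]
      field_simp

lemma tendsto_sumSqXY_div (hc : c ^ 2 = c) (hS : mxy - c * (mx * my) - mu ≠ 0) (k : Kind) :
    Tendsto (fun n : ℕ => sumSqXY k c mu x y n / (f k n * (S c x y n - mu) ^ 2))
      atTop (𝓝 0) := by
  have h1 := (H.tendsto_sumSqXY_div_sq hc k).div
    ((tendsto_f_div k).mul (((H.tendsto_Sxy hc).sub_const mu).pow 2)) (by positivity)
  rw [zero_div] at h1
  refine h1.congr' ?_
  filter_upwards [eventually_ne_atTop 0] with n hn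
  have h0 : (n : ℝ) ≠ 0 := by exact_mod_cast hn
  simp only [Pi.div_apply]
  field_simp

end SampleLimits

end limits

end SEIVM

namespace SEIVM

/-! ### Probabilistic tools -/

section tools

variable {Ω : Type*} [MeasurableSpace Ω] {P : Measure Ω}

/-- Measurable rectangles form a generating π-system, and on them the probability factors first
between the two sequences and then within each. -/
lemma iIndepFun_prodMk [IsProbabilityMeasure P] {E F : Type*} [MeasurableSpace E]
    [MeasurableSpace F] {X : ℕ → Ω → E} {Y : ℕ → Ω → F}
    (mX : ∀ i, Measurable (X i)) (mY : ∀ i, Measurable (Y i)) (hX : iIndepFun X P)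
    (hY : iIndepFun Y P) (hXY : IndepFun (fun ω i => X i ω) (fun ω i => Y i ω) P) :
    iIndepFun (fun i ω => (X i ω, Y i ω)) P := by
  rw [iIndepFun_iff_iIndep]
  let π : ℕ → Set (Set Ω) := fun i =>
    (fun t => (fun ω => (X i ω, Y i ω)) ⁻¹' t) ''
      (Set.image2 (· ×ˢ ·) {a | MeasurableSet a} {b | MeasurableSet b})
  have hgen : ∀ i, MeasurableSpace.comap (fun ω => (X i ω, Y i ω)) inferInstance =
      MeasurableSpace.generateFrom (π i) := fun i => by
    rw [← generateFrom_prod, MeasurableSpace.comap_generateFrom]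
  refine iIndepSets.iIndep (fun i => ((mX i).prodMk (mY i)).comap_le) π (fun i => ?_) hgen ?_
  · exact isPiSystem_prod.comap _
  · rw [iIndepSets_iff]
    intro I f hf
    have hf' : ∀ i, ∃ a b, MeasurableSet a ∧ MeasurableSet b ∧
        (i ∈ I → f i = X i ⁻¹' a ∩ Y i ⁻¹' b) := fun i => by
      by_cases hi : i ∈ I
      · obtain ⟨_, ⟨a, ha, b, hb, rfl⟩, h⟩ := hf i hi
        exact ⟨a, b, ha, hb, fun _ => h.symm⟩
      · exact ⟨∅, ∅, .empty, .empty, fun h => absurd h hi⟩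
    choose a b ha hb hfab using hf'
    have hsub : ∀ i, P (X i ⁻¹' a i ∩ Y i ⁻¹' b i) = P (X i ⁻¹' a i) * P (Y i ⁻¹' b i) := fun i =>
      (hXY.comp (measurable_pi_apply i) (measurable_pi_apply i)).measure_inter_preimage_eq_mul
        _ _ (ha i) (hb i)
    have h1 : (⋂ i ∈ I, f i) = (fun ω i => X i ω) ⁻¹' (⋂ i ∈ I, (fun x => x i) ⁻¹' a i) ∩
        (fun ω i => Y i ω) ⁻¹' (⋂ i ∈ I, (fun y => y i) ⁻¹' b i) := by
      ext ω
      simp only [Set.mem_iInter, Set.mem_inter_iff, Set.mem_preimage]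
      refine ⟨fun h => ⟨fun i hi => ?_, fun i hi => ?_⟩, fun h i hi => ?_⟩
      · have := h i hi; rw [hfab i hi] at this; exact this.1
      · have := h i hi; rw [hfab i hi] at this; exact this.2
      · rw [hfab i hi]; exact ⟨h.1 i hi, h.2 i hi⟩
    rw [h1, hXY.measure_inter_preimage_eq_mul _ _
      (Finset.measurableSet_biInter _ fun i _ => measurable_pi_apply i (ha i))
      (Finset.measurableSet_biInter _ fun i _ => measurable_pi_apply i (hb i)),
      Finset.prod_congr rfl fun i hi => by rw [hfab i hi, hsub i], Finset.prod_mul_distrib]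
    congr 1
    · simp only [Set.preimage_iInter]
      exact (iIndepFun_iff_measure_inter_preimage_eq_mul.1 hX) I fun i _ => ha i
    · simp only [Set.preimage_iInter]
      exact (iIndepFun_iff_measure_inter_preimage_eq_mul.1 hY) I fun i _ => hb i

lemma IID.prodMk [IsProbabilityMeasure P] {E F : Type*} [MeasurableSpace E]
    [MeasurableSpace F] {X : ℕ → Ω → E} {Y : ℕ → Ω → F} (hX : IID P X) (hY : IID P Y)
    (hXY : IndepFun (fun ω i => X i ω) (fun ω i => Y i ω) P) :
    IID P (fun i ω => (X i ω, Y i ω)) where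
  measurable i := (hX.measurable i).prodMk (hY.measurable i)
  indep := iIndepFun_prodMk hX.measurable hY.measurable hX.indep hY.indep hXY
  ident i := by
    have h (j : ℕ) : IndepFun (X j) (Y j) P :=
      hXY.comp (measurable_pi_apply j) (measurable_pi_apply j)
    refine ⟨((hX.measurable i).prodMk (hY.measurable i)).aemeasurable,
      ((hX.measurable 0).prodMk (hY.measurable 0)).aemeasurable, ?_⟩
    rw [(indepFun_iff_map_prod_eq_prod_map_map (hX.measurable i).aemeasurable
      (hY.measurable i).aemeasurable).1 (h i), (indepFun_iff_map_prod_eq_prod_map_map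
      (hX.measurable 0).aemeasurable (hY.measurable 0).aemeasurable).1 (h 0),
      (hX.ident i).map_eq, (hY.ident i).map_eq]

lemma IID.comp {E F : Type*} [MeasurableSpace E] [MeasurableSpace F] {X : ℕ → Ω → E}
    (hX : IID P X) {g : E → F} (hg : Measurable g) : IID P (fun i ω => g (X i ω)) where
  measurable i := hg.comp (hX.measurable i)
  indep := hX.indep.comp (fun _ => g) fun _ => hg
  ident i := (hX.ident i).comp hg

lemma IID.tendsto_mean {X : ℕ → Ω → ℝ} (hX : IID P X) (hint : Integrable (X 0) P) :
    ∀ᵐ ω ∂P, Tendsto (mean fun i => X i ω) atTop (𝓝 (∫ ω, X 0 ω ∂P)) :=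
  strong_law_ae_real X hint (fun _ _ hij => hX.indep.indepFun hij) hX.ident

lemma IID.tendstoInDistribution [IsProbabilityMeasure P] {X : ℕ → Ω → ℝ} (hX : IID P X)
    (h2 : MemLp (X 0) 2 P) :
    TendstoInDistribution
      (fun (n : ℕ) ω => (√n)⁻¹ * (∑ i ∈ Finset.range n, X i ω - n * ∫ ω, X 0 ω ∂P)) atTop
      (fun x : ℝ => √(Var[X 0; P]) * x) (fun _ => P) (gaussianReal 0 1) := by
  refine tendstoInDistribution_inv_sqrt_mul_sum_sub ⟨by fun_prop, ?_⟩ h2 hX.indep hX.ident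
  rw [gaussianReal_map_const_mul]
  congr 1
  · simp
  · ext
    simp [Real.sq_sqrt (variance_nonneg _ _), Real.coe_toNNReal _ (variance_nonneg _ _)]

/-- The portmanteau theorem for continuity sets of the limit law. -/
lemma tendsto_measureReal_preimage [IsProbabilityMeasure P] {Ω' : Type*} [MeasurableSpace Ω']
    {Q : Measure Ω'} [IsProbabilityMeasure Q] {X : ℕ → Ω → ℝ} {Z : Ω' → ℝ}
    (h : TendstoInDistribution X atTop Z (fun _ => P) Q) {A : Set ℝ} (hA : MeasurableSet A)
    (hfr : Q (Z ⁻¹' frontier A) = 0) :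
    Tendsto (fun n => P.real (X n ⁻¹' A)) atTop (𝓝 (Q.real (Z ⁻¹' A))) := by
  have h1 := ProbabilityMeasure.tendsto_measure_of_null_frontier_of_tendsto' h.tendsto (E := A)
    (by
      rw [ProbabilityMeasure.coe_mk, Measure.map_apply_of_aemeasurable h.aemeasurable_limit
        isClosed_frontier.measurableSet]
      exact hfr)
  simp only [ProbabilityMeasure.coe_mk] at h1
  rw [Measure.map_apply_of_aemeasurable h.aemeasurable_limit hA] at h1
  refine ((ENNReal.tendsto_toReal (measure_ne_top _ _)).comp h1).congr fun n => ?_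
  simp only [Function.comp, Measure.real]
  rw [Measure.map_apply_of_aemeasurable (h.forall_aemeasurable n) hA]

lemma tendstoInMeasure_of_tendstoInDistribution_zero [IsProbabilityMeasure P] {Ω' : Type*}
    [MeasurableSpace Ω'] {Q : Measure Ω'} [IsProbabilityMeasure Q] {X : ℕ → Ω → ℝ}
    (h : TendstoInDistribution X atTop (fun _ : Ω' => (0 : ℝ)) (fun _ => P) Q) :
    TendstoInMeasure P X atTop (fun _ => 0) := by
  rw [tendstoInMeasure_iff_measureReal_norm]
  intro e he
  have hcl : IsClosed {x : ℝ | e ≤ ‖x‖} := isClosed_le continuous_const continuous_norm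
  have h0 : (0 : ℝ) ∉ {x : ℝ | e ≤ ‖x‖} := by simpa using he
  have h1 := tendsto_measureReal_preimage h hcl.measurableSet (by
    rw [Set.preimage_const_of_notMem fun h => h0 (hcl.frontier_subset h), measure_empty])
  have h2 : (fun _ : Ω' => (0 : ℝ)) ⁻¹' {x : ℝ | e ≤ ‖x‖} = ∅ :=
    Set.preimage_const_of_notMem h0
  rw [h2, measureReal_empty] at h1
  simpa using h1

lemma tendsto_measureReal_compl [IsProbabilityMeasure P] {G : ℕ → Set Ω}
    (hG : ∀ n, MeasurableSet (G n)) (h : ∀ᵐ ω ∂P, ∀ᶠ n in atTop, ω ∈ G n) :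
    Tendsto (fun n => P.real (G n)ᶜ) atTop (𝓝 0) := by
  have h1 := tendsto_measure_of_ae_tendsto_indicator_of_isFiniteMeasure (μ := P) atTop
    MeasurableSet.empty (fun n => (hG n).compl) (by
      filter_upwards [h] with ω hω
      filter_upwards [hω] with n hn
      simpa using hn)
  simpa [Measure.real, Function.comp_def] using
    (ENNReal.tendsto_toReal (measure_ne_top _ _)).comp h1

/-- Probabilities of events that agree on an event of asymptotically full probability have the same
limit. -/
lemma tendsto_measureReal_congr [IsProbabilityMeasure P] {A E G : ℕ → Set Ω} {p : ℝ}
    (hE : Tendsto (fun n => P.real (E n)) atTop (𝓝 p))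
    (hG : Tendsto (fun n => P.real (G n)ᶜ) atTop (𝓝 0))
    (h : ∀ n, ∀ ω ∈ G n, ω ∈ A n ↔ ω ∈ E n) :
    Tendsto (fun n => P.real (A n)) atTop (𝓝 p) := by
  have hl : ∀ n, P.real (E n) - P.real (G n)ᶜ ≤ P.real (A n) := fun n => by
    rw [sub_le_iff_le_add]
    refine (measureReal_mono fun ω hω => ?_).trans (measureReal_union_le (A n) (G n)ᶜ)
    by_cases hg : ω ∈ G n
    · exact Or.inl ((h n ω hg).2 hω)
    · exact Or.inr hg
  have hu : ∀ n, P.real (A n) ≤ P.real (E n) + P.real (G n)ᶜ := fun n => by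
    refine (measureReal_mono fun ω hω => ?_).trans (measureReal_union_le (E n) (G n)ᶜ)
    by_cases hg : ω ∈ G n
    · exact Or.inl ((h n ω hg).1 hω)
    · exact Or.inr hg
  have h1 := hE.sub hG
  have h2 := hE.add hG
  rw [sub_zero] at h1
  rw [add_zero] at h2
  exact tendsto_of_tendsto_of_tendsto_of_le_of_le h1 h2 hl hu

lemma tendsto_measureReal_one [IsProbabilityMeasure P] {A E G : ℕ → Set Ω}
    (hE : Tendsto (fun n => P.real (E n)) atTop (𝓝 1))
    (hG : Tendsto (fun n => P.real (G n)ᶜ) atTop (𝓝 0))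
    (h : ∀ n, ∀ ω ∈ G n, ω ∈ E n → ω ∈ A n) :
    Tendsto (fun n => P.real (A n)) atTop (𝓝 1) := by
  have hl : ∀ n, P.real (E n) - P.real (G n)ᶜ ≤ P.real (A n) := fun n => by
    rw [sub_le_iff_le_add]
    refine (measureReal_mono fun ω hω => ?_).trans (measureReal_union_le (A n) (G n)ᶜ)
    by_cases hg : ω ∈ G n
    · exact Or.inl (h n ω hg hω)
    · exact Or.inr hg
  have h1 := hE.sub hG
  rw [sub_zero] at h1
  exact tendsto_of_tendsto_of_tendsto_of_le_of_le h1 tendsto_const_nhds hl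
    fun n => measureReal_le_one

/-- By symmetry of the normal law each tail has mass `p / 2`. -/
lemma gaussianReal_real_Icc {z p : ℝ} (hz : 0 ≤ z) (h : cdf (gaussianReal 0 1) z = 1 - p / 2) :
    (gaussianReal 0 1).real (Set.Icc (-z) z) = 1 - p := by
  rw [cdf_eq_real] at h
  have hneg : (gaussianReal 0 1).real (Set.Iio (-z)) = p / 2 := by
    have h1 : (gaussianReal 0 1).map (fun x => -x) = gaussianReal 0 1 := by
      rw [gaussianReal_map_neg, neg_zero]
    have h2 : (gaussianReal 0 1).real (Set.Iio (-z)) = (gaussianReal 0 1).real (Set.Iic z)ᶜ := by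
      conv_lhs => rw [← h1]
      rw [map_measureReal_apply measurable_neg measurableSet_Iio]
      congr 1
      ext x
      simp
    rw [h2, probReal_compl_eq_one_sub measurableSet_Iic, h]
    ring
  have h3 : Set.Icc (-z) z = Set.Iic z \ Set.Iio (-z) := by
    ext x; simp [and_comm]
  rw [h3, measureReal_sdiff (fun x hx => ?_) measurableSet_Iio, h, hneg]
  · ring
  · simp only [Set.mem_Iio, Set.mem_Iic] at hx ⊢
    linarith

/-- If `z ≤ 0`, then `Φ(z) ≤ Φ(-z) ≤ 1 - Φ(z)` by monotonicity and symmetry, so `Φ(z) ≤ 1/2`,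
against `1 - p / 2 > 1/2`. -/
lemma pos_of_cdf_gaussianReal {z p : ℝ} (hp : p < 1)
    (h : cdf (gaussianReal 0 1) z = 1 - p / 2) : 0 < z := by
  have := nullSingletonClass_gaussianReal (μ := 0) one_ne_zero
  by_contra! hz
  have h1 : cdf (gaussianReal 0 1) z ≤ cdf (gaussianReal 0 1) (-z) :=
    monotone_cdf _ (by linarith)
  have h2 : cdf (gaussianReal 0 1) (-z) ≤ 1 - cdf (gaussianReal 0 1) z := by
    rw [cdf_eq_real, cdf_eq_real, ← probReal_compl_eq_one_sub measurableSet_Iic]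
    have h1 : (gaussianReal 0 1).map (fun x => -x) = gaussianReal 0 1 := by
      rw [gaussianReal_map_neg, neg_zero]
    conv_lhs => rw [← h1]
    rw [map_measureReal_apply measurable_neg measurableSet_Iic, Set.compl_Iic,
      measureReal_congr Ioi_ae_eq_Ici]
    refine measureReal_mono fun x hx => ?_
    simpa using hx
  linarith

end tools

end SEIVM

namespace SEIVM

/-! ### The pivots and the limiting coverage -/

/-- The Studentized or self-normalized pivot at the slope `b`. -/
noncomputable def pivot (k : Kind) (b c dd mu : ℝ) (x y : ℕ → ℝ) (n : ℕ) : ℝ :=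
  √(n : ℝ) * mean (u b c dd mu x y n) n *
    (√(f k n / (n : ℝ) ^ 2) / √((∑ i ∈ Finset.range n, resid k b c dd mu x y n i ^ 2) / n))

lemma pivot_sq {k : Kind} {b c dd mu : ℝ} {x y : ℕ → ℝ} {n : ℕ} (hn : 2 ≤ n) :
    pivot k b c dd mu x y n ^ 2 = f k n * mean (u b c dd mu x y n) n ^ 2 /
      ∑ i ∈ Finset.range n, resid k b c dd mu x y n i ^ 2 := by
  have hf := f_pos (k := k) hn
  have hn0 : (0 : ℝ) < n := by positivity
  have hR : 0 ≤ ∑ i ∈ Finset.range n, resid k b c dd mu x y n i ^ 2 := by positivity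
  rw [pivot, mul_pow, mul_pow, div_pow, Real.sq_sqrt hn0.le, Real.sq_sqrt (by positivity),
    Real.sq_sqrt (by positivity)]
  field_simp

/-! ### Measurability of the sample quantities, Slutsky's lemma and coverage. -/

section

variable {Ω : Type*} [MeasurableSpace Ω] {x y : Ω → ℕ → ℝ}

lemma measurable_mean {a : Ω → ℕ → ℝ} (ha : ∀ i, Measurable fun ω => a ω i) (n : ℕ) :
    Measurable fun ω => mean (a ω) n := by
  unfold mean
  fun_prop

lemma measurable_s (c : ℝ) (hx : ∀ i, Measurable fun ω => x ω i)
    (hy : ∀ i, Measurable fun ω => y ω i) (n i : ℕ) :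
    Measurable fun ω => s c (x ω) (y ω) n i := by
  have := measurable_mean hx n
  have := measurable_mean hy n
  unfold s
  fun_prop

lemma measurable_S (c : ℝ) (hx : ∀ i, Measurable fun ω => x ω i)
    (hy : ∀ i, Measurable fun ω => y ω i) (n : ℕ) : Measurable fun ω => S c (x ω) (y ω) n :=
  measurable_mean (measurable_s c hx hy n) n

lemma measurable_gxy (k : Kind) (c mu : ℝ) (hx : ∀ i, Measurable fun ω => x ω i)
    (hy : ∀ i, Measurable fun ω => y ω i) (n : ℕ) :
    Measurable fun ω => gxy k c mu (x ω) (y ω) n := by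
  cases k
  · exact measurable_S c hx hy n
  · exact measurable_const

lemma measurable_gyy (k : Kind) (c dd : ℝ) (hy : ∀ i, Measurable fun ω => y ω i) (n : ℕ) :
    Measurable fun ω => gyy k c dd (y ω) n := by
  cases k
  · exact measurable_S c hy hy n
  · exact measurable_const

lemma measurable_sumSqXY (k : Kind) (c mu : ℝ) (hx : ∀ i, Measurable fun ω => x ω i)
    (hy : ∀ i, Measurable fun ω => y ω i) (n : ℕ) :
    Measurable fun ω => sumSqXY k c mu (x ω) (y ω) n := by
  have := measurable_gxy k c mu hx hy n
  have := measurable_s c hx hy n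
  unfold sumSqXY
  fun_prop

lemma measurable_sum_resid_sq (k : Kind) (b c dd mu : ℝ) (hx : ∀ i, Measurable fun ω => x ω i)
    (hy : ∀ i, Measurable fun ω => y ω i) (n : ℕ) :
    Measurable fun ω => ∑ i ∈ Finset.range n, resid k b c dd mu (x ω) (y ω) n i ^ 2 := by
  have := measurable_gxy k c mu hx hy n
  have := measurable_gyy k c dd hy n
  have := measurable_s c hx hy n
  have := measurable_s c hy hy n
  unfold resid
  fun_prop

variable {P : Measure Ω} [IsProbabilityMeasure P] {β α c dd mu mx my mxx mxy myy h v : ℝ}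

/-- Slutsky twice: the correction is `√n η̄`, which converges in law, times an almost surely
vanishing factor; the normalizing weight converges almost surely to `1 / √v`. -/
lemma tendstoInDistribution_pivot (hc : c ^ 2 = c) (hα : (1 - c) * α = 0)
    (mx' : ∀ i, Measurable fun ω => x ω i) (my' : ∀ i, Measurable fun ω => y ω i)
    (hlim : ∀ᵐ ω ∂P, SampleLimits β α c dd mu mx my mxx mxy myy h v (x ω) (y ω)) (hv : 0 < v)
    (hlead : TendstoInDistribution
      (fun (n : ℕ) ω => √(n : ℝ) * mean (leadTerm β α c my (dd - β * mu) (x ω) (y ω)) n) atTop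
      (fun t : ℝ => √v * t) (fun _ => P) (gaussianReal 0 1))
    (hη : TendstoInDistribution
      (fun (n : ℕ) ω => √(n : ℝ) * mean (lineResid β α (x ω) (y ω)) n) atTop
      (fun t : ℝ => √h * t) (fun _ => P) (gaussianReal 0 1)) (k : Kind) :
    TendstoInDistribution (fun n ω => pivot k β c dd mu (x ω) (y ω) n) atTop
      (fun t : ℝ => t) (fun _ => P) (gaussianReal 0 1) := by
  have mr : ∀ n, Measurable fun ω => -(c * (mean (y ω) n - my)) := fun n => by
    have := measurable_mean my' n
    fun_prop
  have mw : ∀ n : ℕ, Measurable fun ω => √(f k n / (n : ℝ) ^ 2) /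
      √((∑ i ∈ Finset.range n, resid k β c dd mu (x ω) (y ω) n i ^ 2) / n) := fun n => by
    have := measurable_sum_resid_sq k β c dd mu mx' my' n
    fun_prop
  have hR : TendstoInMeasure P (fun n ω => -(c * (mean (y ω) n - my))) atTop (fun _ => 0) := by
    refine tendstoInMeasure_of_tendsto_ae (fun n => (mr n).aestronglyMeasurable) ?_
    filter_upwards [hlim] with ω H
    simpa using ((H.mean_y.sub_const my).const_mul c).neg
  have h1 := hη.continuous_comp_prodMk_of_tendstoInMeasure_const
    (g := fun p : ℝ × ℝ => p.1 * p.2) (by fun_prop) hR (fun n => (mr n).aemeasurable)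
  simp only [mul_zero] at h1
  have h2 := hlead.add_of_tendstoInMeasure_const
    (tendstoInMeasure_of_tendstoInDistribution_zero h1) h1.forall_aemeasurable
  have hw : TendstoInMeasure P (fun n ω => √(f k n / (n : ℝ) ^ 2) /
      √((∑ i ∈ Finset.range n, resid k β c dd mu (x ω) (y ω) n i ^ 2) / n)) atTop
      (fun _ => (√v)⁻¹) := by
    refine tendstoInMeasure_of_tendsto_ae (fun n => (mw n).aestronglyMeasurable) ?_
    filter_upwards [hlim] with ω H
    have := (SampleLimits.tendsto_f_div k).sqrt.div (H.tendsto_sum_resid_sq hc hα k).sqrt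
      (Real.sqrt_pos.2 hv).ne'
    rw [Real.sqrt_one, one_div] at this
    exact this
  have h3 := h2.continuous_comp_prodMk_of_tendstoInMeasure_const
    (g := fun p : ℝ × ℝ => p.1 * p.2) (by fun_prop) hw (fun n => (mw n).aemeasurable)
  have hv' : √v ≠ 0 := (Real.sqrt_pos.2 hv).ne'
  convert! h3 using 3 with n ω t
  · simp only [pivot, mean_u_eq (my := my) hc hα, Pi.add_apply]
    ring
  · field_simp
    simp

lemma tendsto_coverage (hc : c ^ 2 = c) (hα : (1 - c) * α = 0)
    (mx' : ∀ i, Measurable fun ω => x ω i) (my' : ∀ i, Measurable fun ω => y ω i)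
    (hlim : ∀ᵐ ω ∂P, SampleLimits β α c dd mu mx my mxx mxy myy h v (x ω) (y ω)) (hv : 0 < v)
    (hSxy : mxy - c * (mx * my) - mu ≠ 0) (hSyy : 0 < myy - c * (my * my) - dd)
    (hlead : TendstoInDistribution
      (fun (n : ℕ) ω => √(n : ℝ) * mean (leadTerm β α c my (dd - β * mu) (x ω) (y ω)) n) atTop
      (fun t : ℝ => √v * t) (fun _ => P) (gaussianReal 0 1))
    (hη : TendstoInDistribution
      (fun (n : ℕ) ω => √(n : ℝ) * mean (lineResid β α (x ω) (y ω)) n) atTop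
      (fun t : ℝ => √h * t) (fun _ => P) (gaussianReal 0 1)) {γ z : ℝ} (hγ : γ < 1)
    (hz : cdf (gaussianReal 0 1) z = 1 - γ / 2) (k : Kind) :
    Tendsto (fun n : ℕ => P.real {ω | IntervalDefined k c dd mu z (x ω) (y ω) n ∧
        β ∈ interval k c dd mu z (x ω) (y ω) n}) atTop (𝓝 (1 - γ)) ∧
      Tendsto (fun n : ℕ => P.real {ω | IntervalDefined k c dd mu z (x ω) (y ω) n ∧
        B k 1 c dd mu z (x ω) (y ω) n < B k 2 c dd mu z (x ω) (y ω) n ∧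
        interval k c dd mu z (x ω) (y ω) n = pivotSet k c dd mu z (x ω) (y ω) n})
        atTop (𝓝 1) := by
  have hz0 := pos_of_cdf_gaussianReal hγ hz
  have hT := tendstoInDistribution_pivot hc hα mx' my' hlim hv hlead hη k
  have mSxy := fun n => measurable_S c mx' my' n
  have mSyy := fun n => measurable_S c my' my' n
  have mR := fun n => measurable_sum_resid_sq k β c dd mu mx' my' n
  have mQ := fun n => measurable_sumSqXY k c mu mx' my' n
  have := nullSingletonClass_gaussianReal (μ := 0) one_ne_zero
  -- the event on which the interval is a bounded nonempty set given by the pivot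
  let G : ℕ → Set Ω := fun n => {ω | 2 ≤ n ∧ S c (x ω) (y ω) n - mu ≠ 0 ∧
    0 < S c (y ω) (y ω) n - dd ∧ 0 < denom k c mu z (x ω) (y ω) n ∧
    0 < ∑ i ∈ Finset.range n, resid k β c dd mu (x ω) (y ω) n i ^ 2}
  have mG : ∀ n, MeasurableSet (G n) := by
    intro n
    have hd : (fun ω => denom k c mu z (x ω) (y ω) n) = fun ω =>
      f k n * (S c (x ω) (y ω) n - mu) ^ 2 - z ^ 2 * sumSqXY k c mu (x ω) (y ω) n := rfl
    have md : Measurable fun ω => denom k c mu z (x ω) (y ω) n := by rw [hd]; fun_prop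
    refine (MeasurableSet.const _).inter (MeasurableSet.inter ?_ (MeasurableSet.inter ?_
      (MeasurableSet.inter ?_ ?_)))
    · exact (measurableSet_eq_fun ((mSxy n).sub_const mu) measurable_const).compl
    · exact measurableSet_lt measurable_const ((mSyy n).sub_const dd)
    · exact measurableSet_lt measurable_const md
    · exact measurableSet_lt measurable_const (mR n)
  have hG : Tendsto (fun n => P.real (G n)ᶜ) atTop (𝓝 0) := by
    refine tendsto_measureReal_compl mG ?_
    filter_upwards [hlim] with ω H
    filter_upwards [eventually_ge_atTop 2,
      ((H.tendsto_Sxy hc).sub_const mu).eventually_ne hSxy,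
      ((H.tendsto_Syy hc).sub_const dd).eventually (lt_mem_nhds hSyy),
      -- A ratio below `1 / z ^ 2` means exactly that `denom` is positive.
      (H.tendsto_sumSqXY_div hc hSxy k).eventually
        (gt_mem_nhds (by positivity : (0 : ℝ) < 1 / z ^ 2)),
      (H.tendsto_sum_resid_sq hc hα k).eventually (lt_mem_nhds hv)] with n h1 h2 h3 h4 h5
    have hn0 : (0 : ℝ) < n := by positivity
    have hf := f_pos (k := k) h1
    refine ⟨h1, h2, h3, ?_, ?_⟩
    · rw [div_lt_div_iff₀ (by positivity) (by positivity)] at h4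
      exact sub_pos.2 (by rw [sumSqXY] at h4; linarith)
    · exact (div_pos_iff_of_pos_right hn0).1 h5
  have hdef : ∀ n, ∀ ω ∈ G n, IntervalDefined k c dd mu z (x ω) (y ω) n := fun n ω hω =>
    ⟨⟨hω.2.1, hω.2.2.1⟩, D_nonneg hω.2.2.2.1, hω.2.2.2.1.ne'⟩
  constructor
  · have h1 := tendsto_measureReal_preimage hT (measurableSet_Icc (a := -z) (b := z)) (by
      rw [show (fun t : ℝ => t) = id from rfl, Set.preimage_id, frontier_Icc (by linarith)]
      exact (Set.toFinite _).measure_zero _)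
    rw [show (fun t : ℝ => t) = id from rfl, Set.preimage_id,
      gaussianReal_real_Icc hz0.le hz] at h1
    refine tendsto_measureReal_congr h1 hG fun n ω hω => ?_
    obtain ⟨hn, hS, -, hden, hR⟩ := id hω
    simp only [Set.mem_ofPred_eq, hdef n ω hω, true_and, Set.mem_preimage]
    rw [mem_interval_iff hden, mul_assoc, ← mul_pow, betaHat_sub (by omega) hS, Set.mem_Icc,
      ← abs_le, ← abs_of_pos hz0, ← sq_le_sq, abs_of_pos hz0, pivot_sq hn, div_le_iff₀ hR]
  -- The pivot at `β` times this vanishing factor tends to zero in law. Where the product lies in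
  -- `(-1, 1)`, its square is below `1`, which is the hypothesis of `sum_resid_betaHat_pos`.
  · have mr : ∀ n, Measurable fun ω => √(sumSqXY k c mu (x ω) (y ω) n /
        (f k n * (S c (x ω) (y ω) n - mu) ^ 2)) := fun n => by
      have := mSxy n
      have := mQ n
      fun_prop
    have hr : TendstoInMeasure P (fun n ω => √(sumSqXY k c mu (x ω) (y ω) n /
        (f k n * (S c (x ω) (y ω) n - mu) ^ 2))) atTop (fun _ => 0) := by
      refine tendstoInMeasure_of_tendsto_ae (fun n => (mr n).aestronglyMeasurable) ?_
      filter_upwards [hlim] with ω H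
      simpa using (H.tendsto_sumSqXY_div hc hSxy k).sqrt
    have h1 := hT.continuous_comp_prodMk_of_tendstoInMeasure_const
      (g := fun p : ℝ × ℝ => p.1 * p.2) (by fun_prop) hr (fun n => (mr n).aemeasurable)
    simp only [mul_zero] at h1
    have h2 := tendsto_measureReal_preimage h1 (measurableSet_Ioo (a := (-1 : ℝ)) (b := 1)) (by
      rw [frontier_Ioo (by norm_num), Set.preimage_const_of_notMem (by norm_num), measure_empty])
    rw [Set.preimage_const_of_mem (by norm_num), probReal_univ] at h2
    refine tendsto_measureReal_one h2 hG fun n ω hω hE => ?_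
    obtain ⟨hn, hS, -, hden, hR⟩ := id hω
    have hf := f_pos (k := k) hn
    refine ⟨hdef n ω hω, B_one_lt_B_two hz0 hden (sum_resid_betaHat_pos (b := β) (by omega) hS ?_),
      Set.ext fun b => by rw [mem_interval_iff hden, mem_pivotSet_iff hn hz0]⟩
    have hQ : 0 ≤ sumSqXY k c mu (x ω) (y ω) n := Finset.sum_nonneg fun i _ => sq_nonneg _
    have h3 := sq_lt_one_iff_abs_lt_one _ |>.2 (abs_lt.2 hE)
    rw [mul_pow, pivot_sq hn, Real.sq_sqrt (by positivity), div_mul_div_comm,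
      div_lt_one (by positivity)] at h3
    exact h3

end

end SEIVM

namespace SEIVM

/-! ### Moments -/

section moments

variable {Ω : Type*} [MeasurableSpace Ω] {P : Measure Ω}

/-- `f` is integrable with integral `a`. -/
def HasMean (P : Measure Ω) (f : Ω → ℝ) (a : ℝ) : Prop := Integrable f P ∧ ∫ ω, f ω ∂P = a

namespace HasMean

variable {f g : Ω → ℝ} {a b : ℝ}

lemma add (hf : HasMean P f a) (hg : HasMean P g b) : HasMean P (fun ω => f ω + g ω) (a + b) :=
  ⟨hf.1.add hg.1, by rw [integral_add hf.1 hg.1, hf.2, hg.2]⟩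

lemma const_mul (hf : HasMean P f a) (r : ℝ) : HasMean P (fun ω => r * f ω) (r * a) :=
  ⟨hf.1.const_mul r, by rw [integral_const_mul, hf.2]⟩

lemma const [IsProbabilityMeasure P] (r : ℝ) : HasMean P (fun _ => r) r :=
  ⟨integrable_const r, by simp⟩

lemma of_eq (hf : HasMean P f a) (h : ∀ ω, g ω = f ω) (hab : b = a) : HasMean P g b := by
  rw [funext h, hab]; exact hf

lemma mul_of_indepFun (hf : HasMean P f a) (hg : HasMean P g b) (h : IndepFun f g P) :
    HasMean P (fun ω => f ω * g ω) (a * b) :=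
  ⟨h.integrable_mul hf.1 hg.1, by
    rw [h.integral_fun_mul_eq_mul_integral hf.1.aestronglyMeasurable hg.1.aestronglyMeasurable,
      hf.2, hg.2]⟩

end HasMean

lemma memLp_two_mul_of_pow_four {f g : Ω → ℝ} (hf : AEStronglyMeasurable f P)
    (hg : AEStronglyMeasurable g P) (hf4 : Integrable (fun ω => f ω ^ 4) P)
    (hg4 : Integrable (fun ω => g ω ^ 4) P) : MemLp (fun ω => f ω * g ω) 2 P := by
  refine (memLp_two_iff_integrable_sq (hf.mul hg)).2 ?_
  refine (hf4.add hg4).mono' ((hf.mul hg).pow 2) (.of_forall fun ω => ?_)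
  simp only [Pi.mul_apply, Pi.add_apply, Real.norm_eq_abs]
  rw [abs_of_nonneg (sq_nonneg _)]
  nlinarith [sq_nonneg (f ω ^ 2 - g ω ^ 2), sq_nonneg (f ω ^ 2), sq_nonneg (g ω ^ 2)]

/-- Independence replaces the fourth moments by second moments; this is what spares a fourth moment
of `ξ`. -/
lemma memLp_two_mul_of_indepFun {f g : Ω → ℝ} (hf : MemLp f 2 P) (hg : MemLp g 2 P)
    (h : IndepFun f g P) : MemLp (fun ω => f ω * g ω) 2 P := by
  refine (memLp_two_iff_integrable_sq (hf.1.mul hg.1)).2 ?_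
  have := (h.comp (measurable_id.pow_const 2) (measurable_id.pow_const 2)).integrable_mul
    hf.integrable_sq hg.integrable_sq
  simpa [mul_pow, Function.comp_def, Pi.mul_def] using this

lemma IID.tendstoInDistribution_sqrt_mul_mean [IsProbabilityMeasure P] {X : ℕ → Ω → ℝ}
    (hX : IID P X) (h2 : MemLp (X 0) 2 P) (h0 : ∫ ω, X 0 ω ∂P = 0) :
    TendstoInDistribution (fun (n : ℕ) ω => √(n : ℝ) * mean (fun i => X i ω) n) atTop
      (fun x : ℝ => √(∫ ω, X 0 ω ^ 2 ∂P) * x) (fun _ => P) (gaussianReal 0 1) := by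
  have := hX.tendstoInDistribution h2
  rw [variance_of_integral_eq_zero h2.1.aemeasurable h0] at this
  simp only [h0, mul_zero, sub_zero] at this
  convert! this using 3 with n ω
  rcases eq_or_ne n 0 with rfl | hn
  · simp
  · have hn0 : (0 : ℝ) < n := by positivity
    have hs : √(n : ℝ) ≠ 0 := (Real.sqrt_pos.2 hn0).ne'
    rw [mean]
    field_simp
    rw [Real.sq_sqrt hn0.le, mul_comm]

lemma IID.inDAN [IsProbabilityMeasure P] {X : ℕ → Ω → ℝ} (hX : IID P X)
    (h2 : MemLp (X 0) 2 P) (hvar : 0 < Var[X 0; P]) : IIDInDAN P X := by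
  have hs := Real.sqrt_pos.2 hvar
  -- The value `1` at `n = 0` only keeps the norming constants positive.
  refine ⟨hX, fun n => n * ∫ ω, X 0 ω ∂P, fun n => if n = 0 then 1 else √n * √(Var[X 0; P]),
    fun n => ?_, ?_⟩
  · dsimp only
    split_ifs with hn
    · exact one_pos
    · have : (0 : ℝ) < n := by positivity
      positivity
  · have h1 := (hX.tendstoInDistribution h2).continuous_comp
      (g := fun t : ℝ => (√(Var[X 0; P]))⁻¹ * t) (by fun_prop)
    convert! h1 using 3 with n ω t
    · rcases eq_or_ne n 0 with rfl | hn
      · simp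
      · simp only [hn, if_false, Function.comp, mul_inv]
        ring
    · funext t
      simp [hs.ne']

end moments

/-! ### Moments of the errors and of the leading term. -/

section model

variable {Ω : Type*} [MeasurableSpace Ω] {P : Measure Ω} [IsProbabilityMeasure P]
  {ξ δ ε : ℕ → Ω → ℝ} {β lam θ mu : ℝ}

omit [IsProbabilityMeasure P] in
lemma ErrorCondition.measurable_δ (hA : ErrorCondition P δ ε lam θ mu) (i : ℕ) :
    Measurable (δ i) := measurable_fst.comp (hA.iid.measurable i)

omit [IsProbabilityMeasure P] in
lemma ErrorCondition.measurable_ε (hA : ErrorCondition P δ ε lam θ mu) (i : ℕ) :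
    Measurable (ε i) := measurable_snd.comp (hA.iid.measurable i)

/-- The general coefficients allow all required first and second order error terms to be read off by
specialization. -/
lemma ErrorCondition.memLp_mul (hA : ErrorCondition P δ ε lam θ mu) (a b r a' b' r' : ℝ) :
    MemLp (fun ω => (a * δ 0 ω + b * ε 0 ω + r) * (a' * δ 0 ω + b' * ε 0 ω + r')) 2 P := by
  have mδ := (hA.measurable_δ 0).aestronglyMeasurable (μ := P)
  have mε := (hA.measurable_ε 0).aestronglyMeasurable (μ := P)
  have hδε := memLp_two_mul_of_pow_four mδ mε hA.integrable_δ hA.integrable_ε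
  have hδδ := memLp_two_mul_of_pow_four mδ mδ hA.integrable_δ hA.integrable_δ
  have hεε := memLp_two_mul_of_pow_four mε mε hA.integrable_ε hA.integrable_ε
  have hδ := memLp_two_mul_of_pow_four mδ (aestronglyMeasurable_const (b := (1 : ℝ)))
    hA.integrable_δ (integrable_const _)
  have hε := memLp_two_mul_of_pow_four mε (aestronglyMeasurable_const (b := (1 : ℝ)))
    hA.integrable_ε (integrable_const _)
  have := (((((hδδ.const_mul (a * a')).add (hδε.const_mul (a * b' + b * a'))).add
    (hεε.const_mul (b * b'))).add (hδ.const_mul (a * r' + r * a'))).add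
    (hε.const_mul (b * r' + r * b'))).add (memLp_const (r * r'))
  refine this.ae_eq (.of_forall fun ω => ?_)
  simp only [Pi.add_apply]
  ring

lemma ErrorCondition.memLp (hA : ErrorCondition P δ ε lam θ mu) (a b r : ℝ) :
    MemLp (fun ω => a * δ 0 ω + b * ε 0 ω + r) 2 P := by
  simpa using hA.memLp_mul a b r 0 0 1

lemma ErrorCondition.hasMean_δ (hA : ErrorCondition P δ ε lam θ mu) : HasMean P (δ 0) 0 :=
  ⟨by simpa using (hA.memLp 1 0 0).integrable (by norm_num), hA.mean_δ⟩

lemma ErrorCondition.hasMean_ε (hA : ErrorCondition P δ ε lam θ mu) : HasMean P (ε 0) 0 :=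
  ⟨by simpa using (hA.memLp 0 1 0).integrable (by norm_num), hA.mean_ε⟩

lemma ErrorCondition.hasMean_δ_sq (hA : ErrorCondition P δ ε lam θ mu) :
    HasMean P (fun ω => δ 0 ω ^ 2) (lam * θ) := by
  refine ⟨by simpa using (hA.memLp 1 0 0).integrable_sq, ?_⟩
  rw [← hA.var_δ, variance_of_integral_eq_zero (hA.measurable_δ 0).aemeasurable hA.mean_δ]

lemma ErrorCondition.hasMean_ε_sq (hA : ErrorCondition P δ ε lam θ mu) :
    HasMean P (fun ω => ε 0 ω ^ 2) θ := by
  refine ⟨by simpa using (hA.memLp 0 1 0).integrable_sq, ?_⟩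
  rw [← hA.var_ε, variance_of_integral_eq_zero (hA.measurable_ε 0).aemeasurable hA.mean_ε]

lemma ErrorCondition.hasMean_δ_mul_ε (hA : ErrorCondition P δ ε lam θ mu) :
    HasMean P (fun ω => δ 0 ω * ε 0 ω) mu := by
  refine ⟨by simpa using (hA.memLp_mul 1 0 0 0 1 0).integrable (by norm_num), ?_⟩
  rw [← hA.cov_δε, covariance, hA.mean_δ, hA.mean_ε]
  simp

omit [IsProbabilityMeasure P] in
lemma ErrorCondition.quadratic_pos (hA : ErrorCondition P δ ε lam θ mu) (β : ℝ) :
    0 < lam * θ - 2 * β * mu + β ^ 2 * θ := by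
  -- The vector `(1, -β)` turns the covariance form into the variance of `δ - β ε`.
  have h := hA.posDef.dotProduct_mulVec_pos (x := ![1, -β])
    fun h => one_ne_zero (congrFun h 0)
  simp [Matrix.mulVec, dotProduct, Fin.sum_univ_two] at h
  linarith

lemma ErrorCondition.hasMean_η_sq (hA : ErrorCondition P δ ε lam θ mu) (β : ℝ) :
    HasMean P (fun ω => (δ 0 ω - β * ε 0 ω) ^ 2) (lam * θ - 2 * β * mu + β ^ 2 * θ) :=
  ((hA.hasMean_δ_sq.add (hA.hasMean_δ_mul_ε.const_mul (-2 * β))).add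
    (hA.hasMean_ε_sq.const_mul (β ^ 2))).of_eq (fun ω => by ring) (by ring)

/-- The second moment of the leading term `(β ξ + r + δ) (δ - β ε) - κ` is positive. -/
lemma integral_leadTerm_sq_pos (hA : ErrorCondition P δ ε lam θ mu) (hξ2 : MemLp (ξ 0) 2 P)
    (hξvar : 0 < Var[ξ 0; P]) (hind : IndepFun (ξ 0) (fun ω => (δ 0 ω, ε 0 ω)) P) (hβ : β ≠ 0)
    (r κ : ℝ) :
    MemLp (fun ω => (β * ξ 0 ω + r + δ 0 ω) * (δ 0 ω - β * ε 0 ω) - κ) 2 P ∧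
    0 < ∫ ω, ((β * ξ 0 ω + r + δ 0 ω) * (δ 0 ω - β * ε 0 ω) - κ) ^ 2 ∂P := by
  set m := ∫ ω, ξ 0 ω ∂P with hm
  -- The variable is `β (ξ - m) η + w`, with `w` a function of the errors alone. As `ξ - m` is
  -- centred and independent of the errors, the cross term has mean zero, and the second moment is
  -- at least `β² Var ξ · E η² > 0`.
  let w : Ω → ℝ := fun ω => (δ 0 ω + (β * m + r)) * (δ 0 ω - β * ε 0 ω) - κ
  have hw : MemLp w 2 P := by
    refine ((hA.memLp_mul 1 0 (β * m + r) 1 (-β) 0).sub (memLp_const κ)).ae_eq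
      (.of_forall fun ω => ?_)
    simp only [Pi.sub_apply, w]
    ring
  have hη : MemLp (fun ω => δ 0 ω - β * ε 0 ω) 2 P := by
    refine (hA.memLp 1 (-β) 0).ae_eq (.of_forall fun ω => ?_)
    ring
  have hξm : MemLp (fun ω => ξ 0 ω - m) 2 P := hξ2.sub (memLp_const m)
  have hξη : IndepFun (fun ω => ξ 0 ω - m) (fun ω => δ 0 ω - β * ε 0 ω) P :=
    hind.comp (φ := fun t => t - m) (ψ := fun p : ℝ × ℝ => p.1 - β * p.2) (by fun_prop) (by fun_prop)
  have h1 : HasMean P (fun ω => (ξ 0 ω - m) ^ 2 * (δ 0 ω - β * ε 0 ω) ^ 2)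
      (Var[ξ 0; P] * (lam * θ - 2 * β * mu + β ^ 2 * θ)) := by
    refine HasMean.mul_of_indepFun ⟨hξm.integrable_sq, ?_⟩ (hA.hasMean_η_sq β)
      (hξη.comp (φ := fun t => t ^ 2) (ψ := fun t => t ^ 2) (by fun_prop) (by fun_prop))
    rw [variance_eq_integral hξ2.1.aemeasurable]
  have h2 : HasMean P (fun ω => (ξ 0 ω - m) * ((δ 0 ω - β * ε 0 ω) * w ω))
      (0 * ∫ ω, (δ 0 ω - β * ε 0 ω) * w ω ∂P) := by
    refine HasMean.mul_of_indepFun ⟨hξm.integrable (by norm_num), ?_⟩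
      ⟨hη.integrable_mul hw, rfl⟩
      (hind.comp (φ := fun t => t - m) (ψ := fun p : ℝ × ℝ => (p.1 - β * p.2) *
        ((p.1 + (β * m + r)) * (p.1 - β * p.2) - κ)) (by fun_prop) (by fun_prop))
    rw [integral_sub (hξ2.integrable (by norm_num)) (integrable_const m)]
    simp [hm]
  have h3 : HasMean P (fun ω => w ω ^ 2) (∫ ω, w ω ^ 2 ∂P) := ⟨hw.integrable_sq, rfl⟩
  have h4 := ((h1.const_mul (β ^ 2)).add (h2.const_mul (2 * β))).add h3
  constructor
  · refine (((memLp_two_mul_of_indepFun hξm hη hξη).const_mul β).add hw).ae_eq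
      (.of_forall fun ω => ?_)
    simp only [Pi.add_apply, w]
    ring
  · have h5 := h4.of_eq (g := fun ω => ((β * ξ 0 ω + r + δ 0 ω) * (δ 0 ω - β * ε 0 ω) - κ) ^ 2)
      (fun ω => by simp only [w]; ring) rfl
    rw [h5.2]
    have hq := hA.quadratic_pos β
    have hw0 : 0 ≤ ∫ ω, w ω ^ 2 ∂P := integral_nonneg fun ω => sq_nonneg _
    have hpos := mul_pos (by positivity : 0 < β ^ 2) (mul_pos hξvar hq)
    linarith

end model

end SEIVM

namespace SEIVM

/-! ### Specialization to the structural model. -/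

section model

variable {Ω : Type*} [MeasurableSpace Ω] {P : Measure Ω} [IsProbabilityMeasure P]
  {ξ δ ε : ℕ → Ω → ℝ} {β α : ℝ}

lemma memLp_two_of_integrable_abs_rpow {f : Ω → ℝ} (hf : AEStronglyMeasurable f P)
    (h : Integrable (fun ω => |f ω| ^ (8 / 3 : ℝ)) P) : MemLp f 2 P := by
  have h1 : MemLp f (ENNReal.ofReal (8 / 3)) P := by
    rw [← integrable_norm_rpow_iff hf (by simp) (by simp),
      ENNReal.toReal_ofReal (by norm_num)]
    exact h
  refine h1.mono_exponent ?_
  rw [show (2 : ENNReal) = ENNReal.ofReal 2 by simp]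
  exact ENNReal.ofReal_le_ofReal (by norm_num)

omit [IsProbabilityMeasure P] in
lemma IID.tendsto_mean_of_hasMean {X : ℕ → Ω → ℝ} {a : ℝ} (hX : IID P X)
    (h : HasMean P (X 0) a) : ∀ᵐ ω ∂P, Tendsto (mean fun i => X i ω) atTop (𝓝 a) :=
  h.2 ▸ hX.tendsto_mean h.1

omit [MeasurableSpace Ω] in
lemma lineResid_obs (ω : Ω) (i : ℕ) :
    lineResid β α (obsX ξ ε ω) (obsY β α ξ δ ω) i = δ i ω - β * ε i ω := by
  simp only [lineResid, obsX, obsY]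
  ring

end model

end SEIVM

theorem theorem4 {Ω : Type*} [MeasurableSpace Ω] (P : Measure Ω) [IsProbabilityMeasure P]
    (ξ δ ε : ℕ → Ω → ℝ) (β α lam θ mu c : ℝ)
    -- the errors
    (hA : SEIVM.ErrorCondition P δ ε lam θ mu)
    -- the explanatory variables: i.i.d., non-degenerate, with a finite moment of order 8/3
    (hξ : SEIVM.IID P ξ)
    (hξvar : 0 < Var[ξ 0; P])
    (hξmom : Integrable (fun ω => |ξ 0 ω| ^ (8 / 3 : ℝ)) P)
    -- the explanatory variables are independent of the errors
    (hC : IndepFun (fun ω i => (δ i ω, ε i ω)) (fun ω i => ξ i ω) P)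
    (hβ : β ≠ 0)
    -- no intercept (`c = 0`), or unknown intercept (`c = 1`)
    (hc : (c = 0 ∧ α = 0) ∨ c = 1) :
    SEIVM.IIDInDAN P ξ ∧
    ∀ (γ z : ℝ), 0 < γ → γ < 1 → cdf (gaussianReal 0 1) z = 1 - γ / 2 →
      ∀ k : SEIVM.Kind,
        Tendsto (fun n : ℕ => P.real {ω |
            SEIVM.IntervalDefined k c (lam * θ) mu z (SEIVM.obsX ξ ε ω) (SEIVM.obsY β α ξ δ ω) n ∧
            β ∈ SEIVM.interval k c (lam * θ) mu z
              (SEIVM.obsX ξ ε ω) (SEIVM.obsY β α ξ δ ω) n})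
          atTop (𝓝 (1 - γ)) ∧
        Tendsto (fun n : ℕ => P.real {ω |
            SEIVM.IntervalDefined k c (lam * θ) mu z (SEIVM.obsX ξ ε ω) (SEIVM.obsY β α ξ δ ω) n ∧
            SEIVM.B k 1 c (lam * θ) mu z (SEIVM.obsX ξ ε ω) (SEIVM.obsY β α ξ δ ω) n <
              SEIVM.B k 2 c (lam * θ) mu z (SEIVM.obsX ξ ε ω) (SEIVM.obsY β α ξ δ ω) n ∧
            SEIVM.interval k c (lam * θ) mu z (SEIVM.obsX ξ ε ω) (SEIVM.obsY β α ξ δ ω) n =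
              SEIVM.pivotSet k c (lam * θ) mu z (SEIVM.obsX ξ ε ω) (SEIVM.obsY β α ξ δ ω) n})
          atTop (𝓝 1) := by
  have hξ2 : MemLp (ξ 0) 2 P := SEIVM.memLp_two_of_integrable_abs_rpow
    (hξ.measurable 0).aestronglyMeasurable hξmom
  refine ⟨hξ.inDAN hξ2 hξvar, fun γ z _ hγ hz k => ?_⟩
  have hc2 : c ^ 2 = c := by rcases hc with ⟨rfl, -⟩ | rfl <;> norm_num
  have hα : (1 - c) * α = 0 := by rcases hc with ⟨-, rfl⟩ | rfl <;> norm_num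
  have hind : IndepFun (ξ 0) (fun ω => (δ 0 ω, ε 0 ω)) P :=
    (hC.comp (measurable_pi_apply 0) (measurable_pi_apply 0)).symm
  set m := ∫ ω, ξ 0 ω ∂P with hm
  set q := ∫ ω, ξ 0 ω ^ 2 ∂P with hq
  have hvar : Var[ξ 0; P] = q - m ^ 2 := variance_eq_sub hξ2
  have Mξ : SEIVM.HasMean P (ξ 0) m := ⟨hξ2.integrable (by norm_num), rfl⟩
  have Mξξ : SEIVM.HasMean P (fun ω => ξ 0 ω ^ 2) q := ⟨hξ2.integrable_sq, rfl⟩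
  have Mδ := hA.hasMean_δ
  have Mε := hA.hasMean_ε
  have Mδδ := hA.hasMean_δ_sq
  have Mδε := hA.hasMean_δ_mul_ε
  have Mξδ := Mξ.mul_of_indepFun Mδ (hind.comp measurable_id measurable_fst)
  have Mξε := Mξ.mul_of_indepFun Mε (hind.comp measurable_id measurable_snd)
  have M1 : SEIVM.HasMean P (fun _ => (1 : ℝ)) 1 := .const 1
  -- The triples `(ξ_i, (δ_i, ε_i))` are i.i.d., and every sequence below is a fixed measurable
  -- function of them.
  have hT := hξ.prodMk hA.iid hC.symm
  have Ix : SEIVM.IID P (fun i ω => SEIVM.obsX ξ ε ω i) :=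
    hT.comp (g := fun t => t.1 + t.2.2) (by fun_prop)
  have Iy : SEIVM.IID P (fun i ω => SEIVM.obsY β α ξ δ ω i) :=
    hT.comp (g := fun t => β * t.1 + α + t.2.1) (by fun_prop)
  have Ixy : SEIVM.IID P (fun i ω => SEIVM.obsX ξ ε ω i * SEIVM.obsY β α ξ δ ω i) :=
    hT.comp (g := fun t => (t.1 + t.2.2) * (β * t.1 + α + t.2.1)) (by fun_prop)
  have Iη : SEIVM.IID P
      (fun i ω => SEIVM.lineResid β α (SEIVM.obsX ξ ε ω) (SEIVM.obsY β α ξ δ ω) i) :=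
    hT.comp (g := fun t => (β * t.1 + α + t.2.1) - β * (t.1 + t.2.2) - α) (by fun_prop)
  have Il : SEIVM.IID P (fun i ω => SEIVM.leadTerm β α c (β * m + α) (lam * θ - β * mu)
      (SEIVM.obsX ξ ε ω) (SEIVM.obsY β α ξ δ ω) i) :=
    hT.comp (g := fun t => (β * t.1 + α + t.2.1 - c * (β * m + α)) *
      ((β * t.1 + α + t.2.1) - β * (t.1 + t.2.2) - α) - (lam * θ - β * mu)) (by fun_prop)
  have Mx : SEIVM.HasMean P (fun ω => SEIVM.obsX ξ ε ω 0) m :=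
    (Mξ.add Mε).of_eq (fun ω => rfl) (by ring)
  have My : SEIVM.HasMean P (fun ω => SEIVM.obsY β α ξ δ ω 0) (β * m + α) :=
    (((Mξ.const_mul β).add (M1.const_mul α)).add Mδ).of_eq
      (fun ω => by simp only [SEIVM.obsY]; ring) (by ring)
  have Mxx : SEIVM.HasMean P (fun ω => SEIVM.obsX ξ ε ω 0 ^ 2) (q + θ) :=
    ((Mξξ.add (Mξε.const_mul 2)).add hA.hasMean_ε_sq).of_eq
      (fun ω => by simp only [SEIVM.obsX]; ring) (by ring)
  have Mxy : SEIVM.HasMean P (fun ω => SEIVM.obsX ξ ε ω 0 * SEIVM.obsY β α ξ δ ω 0)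
      (β * q + α * m + mu) :=
    ((((((Mξξ.const_mul β).add (Mξ.const_mul α)).add Mξδ).add (Mξε.const_mul β)).add
      (Mε.const_mul α)).add Mδε).of_eq
      (fun ω => by simp only [SEIVM.obsX, SEIVM.obsY]; ring) (by ring)
  have Myy : SEIVM.HasMean P (fun ω => SEIVM.obsY β α ξ δ ω 0 * SEIVM.obsY β α ξ δ ω 0)
      (β ^ 2 * q + 2 * α * β * m + α ^ 2 + lam * θ) :=
    ((((((Mξξ.const_mul (β ^ 2)).add (Mξ.const_mul (2 * α * β))).add
      (M1.const_mul (α ^ 2))).add Mδδ).add (Mξδ.const_mul (2 * β))).add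
      (Mδ.const_mul (2 * α))).of_eq
      (fun ω => by simp only [SEIVM.obsY]; ring) (by ring)
  have Mη : SEIVM.HasMean P
      (fun ω => SEIVM.lineResid β α (SEIVM.obsX ξ ε ω) (SEIVM.obsY β α ξ δ ω) 0) 0 :=
    (Mδ.add (Mε.const_mul (-β))).of_eq
      (fun ω => by rw [SEIVM.lineResid_obs]; ring) (by ring)
  have Mηη : SEIVM.HasMean P
      (fun ω => SEIVM.lineResid β α (SEIVM.obsX ξ ε ω) (SEIVM.obsY β α ξ δ ω) 0 ^ 2)
      (lam * θ - 2 * β * mu + β ^ 2 * θ) :=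
    (hA.hasMean_η_sq β).of_eq (fun ω => by rw [SEIVM.lineResid_obs]) rfl
  -- The mean vanishes since `E[δ η] = λθ - βμ`, while `ξ` and constants contribute nothing against
  -- the centred, independent `η`.
  have Ml : SEIVM.HasMean P (fun ω => SEIVM.leadTerm β α c (β * m + α) (lam * θ - β * mu)
      (SEIVM.obsX ξ ε ω) (SEIVM.obsY β α ξ δ ω) 0) 0 :=
    (((((((Mξδ.const_mul β).add (Mξε.const_mul (-β ^ 2))).add Mδδ).add
      (Mδε.const_mul (-β))).add (Mδ.const_mul (α - c * (β * m + α)))).add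
      (Mε.const_mul (-β * (α - c * (β * m + α))))).add
      (M1.const_mul (-(lam * θ - β * mu)))).of_eq
      (fun ω => by simp only [SEIVM.leadTerm, SEIVM.lineResid_obs, SEIVM.obsY]; ring) (by ring)
  obtain ⟨Ll, hv⟩ := SEIVM.integral_leadTerm_sq_pos hA hξ2 hξvar hind hβ
    (α - c * (β * m + α)) (lam * θ - β * mu)
  have hl : ∀ ω, SEIVM.leadTerm β α c (β * m + α) (lam * θ - β * mu)
      (SEIVM.obsX ξ ε ω) (SEIVM.obsY β α ξ δ ω) 0 =
      (β * ξ 0 ω + (α - c * (β * m + α)) + δ 0 ω) * (δ 0 ω - β * ε 0 ω)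
        - (lam * θ - β * mu) := fun ω => by
    simp only [SEIVM.leadTerm, SEIVM.lineResid_obs, SEIVM.obsY]
    ring
  simp only [← hl] at Ll hv
  have Lη : MemLp (fun ω => SEIVM.lineResid β α (SEIVM.obsX ξ ε ω) (SEIVM.obsY β α ξ δ ω) 0)
      2 P :=
    (hA.memLp 1 (-β) 0).ae_eq (.of_forall fun ω => by simp only [SEIVM.lineResid_obs]; ring)
  have hlim : ∀ᵐ ω ∂P, SEIVM.SampleLimits β α c (lam * θ) mu m (β * m + α) (q + θ)
      (β * q + α * m + mu) (β ^ 2 * q + 2 * α * β * m + α ^ 2 + lam * θ)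
      (lam * θ - 2 * β * mu + β ^ 2 * θ)
      (∫ ω, SEIVM.leadTerm β α c (β * m + α) (lam * θ - β * mu)
        (SEIVM.obsX ξ ε ω) (SEIVM.obsY β α ξ δ ω) 0 ^ 2 ∂P)
      (SEIVM.obsX ξ ε ω) (SEIVM.obsY β α ξ δ ω) := by
    filter_upwards [Ix.tendsto_mean_of_hasMean Mx, Iy.tendsto_mean_of_hasMean My,
      (Ix.comp (measurable_id.pow_const 2)).tendsto_mean_of_hasMean Mxx,
      Ixy.tendsto_mean_of_hasMean Mxy,
      (Iy.comp (g := fun t => t * t) (by fun_prop)).tendsto_mean_of_hasMean Myy,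
      Iη.tendsto_mean_of_hasMean Mη,
      (Iη.comp (measurable_id.pow_const 2)).tendsto_mean_of_hasMean Mηη,
      Il.tendsto_mean_of_hasMean Ml,
      (Il.comp (measurable_id.pow_const 2)).tendsto_mean_of_hasMean ⟨Ll.integrable_sq, rfl⟩]
      with ω h1 h2 h3 h4 h5 h6 h7 h8 h9
    exact ⟨h1, h2, h3, h4, h5, h6, h7, h8, h9⟩
  have hη := Iη.tendstoInDistribution_sqrt_mul_mean Lη Mη.2
  rw [Mηη.2] at hη
  -- This number is `E ξ²` for `c = 0` and `Var ξ` for `c = 1`. The limits of `S_xy - μ` and `S_yy -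
  -- λθ` are `β` and `β²` times it.
  have hcm : 0 < q - c * m ^ 2 := by
    rcases hc with ⟨rfl, -⟩ | rfl
    · nlinarith [sq_nonneg m]
    · linarith
  refine SEIVM.tendsto_coverage hc2 hα (fun i => Ix.measurable i) (fun i => Iy.measurable i) hlim
    hv ?_ ?_ (Il.tendstoInDistribution_sqrt_mul_mean Ll Ml.2) hη hγ hz k
  · rw [show β * q + α * m + mu - c * (m * (β * m + α)) - mu = β * (q - c * m ^ 2) by
      linear_combination m * hα]
    exact mul_ne_zero hβ hcm.ne'
  · rw [show β ^ 2 * q + 2 * α * β * m + α ^ 2 + lam * θ - c * ((β * m + α) * (β * m + α))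
      - lam * θ = β ^ 2 * (q - c * m ^ 2) by linear_combination (2 * β * m + α) * hα]
    positivity
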